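/- **Setting.** Let $\chi,\varphi\in C_0^\infty(\mathbb R^3)$ take values in $[0,1]$, with $\operatorname{supp}\chi\subset\{|\xi|\le 4/3\}$, $\operatorname{supp}\varphi\subset\{3/4\le|\xi|\le 8/3\}$, $\chi(\xi)+\sum_{j\ge0}\varphi(2^{-j}\xi)=1$ for all $\xi\in\mathbb R^3$ and $\sum_{j\in\mathbb Z}\varphi(2^{-j}\xi)=1$ for all $\xi\ne0$. For a (vector-valued) tempered distribution $f$ on $\mathbb R^3$ and $j\in\mathbb Z$ put $\dot\Delta_jf=\mathcal F^{-1}(\varphi(2^{-j}\xi)\mathcal F f)$ and $\dot S_jf=\mathcal F^{-1}(\chi(2^{-j}\xi)\mathcal F f)$. For $s\in\mathbb R$ and $p,q\in[1,\infty]$, the homogeneous Besov space $\dot B^s_{p,q}(\mathbb R^3)$ consists of the tempered distributions $f$ with $\lim_{j\to-\infty}\|\dot S_jf\|_{L_\infty}=0$ and $$\|f\|_{\dot B^s_{p,q}}=\Big(\sum_{j\in\mathbb Z}2^{jsq}\|\dot\Delta_jf\|_{L_p}^q\Big)^{1/q}<\infty$$ (the supremum $\sup_j 2^{js}\|\dot\Delta_jf\|_{L_p}$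 if $q=\infty$). For $r>3$ write $s_r=-1+3/r$. **Proposition.** Let $3<p<\infty$. There are $p_2\in(p,\infty)$, $0<\delta_2<-s_{p_2}$, $\gamma_1>0$ and $\gamma_2>0$, depending only on $p$, such that for every pair $(\chi,\varphi)$ as above there is a function $C(p,\cdot):[0,\infty)\to[0,\infty)$ (depending on $p$ and the pair $(\chi,\varphi)$ only) with the following property. Let $g\in\dot B^{s_p}_{p,\infty}(\mathbb R^3)$ be a $\mathbb C^3$-valued tempered distribution with $\operatorname{div}g=0$ in the sense of tempered distributions. Then for every $N>0$ there are divergence-free tempered distributions $$\bar g^N\in\dot B^{s_{p_2}+\delta_2}_{p_2,p_2}(\mathbb R^3)\cap\dot B^{s_p}_{p,\infty}(\mathbb R^3),\qquad \widetilde g^N\in L_2(\mathbb R^3)\cap\dot B^{s_p}_{p,\infty}(\mathbb R^3),$$ both of them real if $g$ is real, such that $g=\bar g^N+\widetilde g^N$ and $$\|\bar g^N\|_{\dot B^{s_{p_2}+\delta_2}_{p_2,p_2}}\le N^{\gamma_1}C(p,\|g\|_{\dot B^{s_p}_{p,\infty}}),\qquad \|\widetilde g^N\|_{L_2}\le N^{-\gamma_2}C(p,\|g\|_{\dot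 B^{s_p}_{p,\infty}}),$$ $$\|\bar g^N\|_{\dot B^{s_p}_{p,\infty}}\le C(p,\|g\|_{\dot B^{s_p}_{p,\infty}}),\qquad \|\widetilde g^N\|_{\dot B^{s_p}_{p,\infty}}\le C(p,\|g\|_{\dot B^{s_p}_{p,\infty}}).$$ -/

import Mathlib

open MeasureTheory Filter Topology FourierTransform LineDeriv
open scoped ENNReal NNReal SchwartzMap ContDiff

noncomputable section

namespace HomBesov

/-- Physical space `ℝ³` (and also frequency space). -/
abbrev R3 : Type := EuclideanSpace ℝ (Fin 3)

/-- Values of a vector field on `ℝ³`; Mathlib's tempered distributions take values in complex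
spaces, and real fields are singled out by `IsReal` below. -/
abbrev C3 : Type := EuclideanSpace ℂ (Fin 3)

/-- The pairs `(χ, φ)` of cut-off functions of the dyadic partition of unity. -/
structure IsLittlewoodPaleyPair (χ φ : R3 → ℝ) : Prop where
  smooth_χ : ContDiff ℝ ∞ χ
  smooth_φ : ContDiff ℝ ∞ φ
  supp_χ : tsupport χ ⊆ {ξ | ‖ξ‖ ≤ 4 / 3}
  supp_φ : tsupport φ ⊆ {ξ | 3 / 4 ≤ ‖ξ‖ ∧ ‖ξ‖ ≤ 8 / 3}
  range_χ : ∀ ξ, 0 ≤ χ ξ ∧ χ ξ ≤ 1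
  range_φ : ∀ ξ, 0 ≤ φ ξ ∧ φ ξ ≤ 1
  /-- `χ(ξ) + ∑_{j ≥ 0} φ(2^{-j} ξ) = 1` for every `ξ`. -/
  sum_nat : ∀ ξ, HasSum (fun j : ℕ => φ ((2 : ℝ) ^ (-(j : ℤ)) • ξ)) (1 - χ ξ)
  /-- `∑_{j ∈ ℤ} φ(2^{-j} ξ) = 1` for every `ξ ≠ 0`. -/
  sum_int : ∀ ξ, ξ ≠ 0 → HasSum (fun j : ℤ => φ ((2 : ℝ) ^ (-j) • ξ)) 1

/-- `𝓕⁻¹ (m(2^{-j} ξ) 𝓕 f)`. With `m = φ` this is the homogeneous dyadic block `Δ_j f`, with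
`m = χ` the low frequency cut-off `S_j f`. -/
def dyadicCutoff (m : R3 → ℝ) (j : ℤ) (f : 𝓢'(R3, C3)) : 𝓢'(R3, C3) :=
  TemperedDistribution.fourierMultiplierCLM C3
    (fun ξ : R3 => ((m ((2 : ℝ) ^ (-j) • ξ) : ℝ) : ℂ)) f

/-- The `L_p` norm (`1 ≤ p ≤ ∞`) of a tempered distribution: the norm of the `L_p` function that
represents it, and `∞` if there is none. -/
def distLpNorm (p : ℝ≥0∞) (f : 𝓢'(R3, C3)) : ℝ≥0∞ :=
  ⨅ (h : R3 → C3) (_ : MemLp h p volume) (_ : ∀ ψ : 𝓢(R3, ℂ), f ψ = ∫ x, ψ x • h x),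
    eLpNorm h p volume

/-- The homogeneous Besov norm
`(∑_j 2^{jsq} ‖Δ_j f‖_{L_p}^q)^{1/q}`, with the supremum over `j` if `q = ∞`. -/
def besovNorm (φ : R3 → ℝ) (s : ℝ) (p q : ℝ≥0∞) (f : 𝓢'(R3, C3)) : ℝ≥0∞ :=
  if q = ⊤ then
    ⨆ j : ℤ, ENNReal.ofReal ((2 : ℝ) ^ ((j : ℝ) * s)) * distLpNorm p (dyadicCutoff φ j f)
  else
    (∑' j : ℤ, ENNReal.ofReal ((2 : ℝ) ^ ((j : ℝ) * s * q.toReal)) *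
      distLpNorm p (dyadicCutoff φ j f) ^ q.toReal) ^ (1 / q.toReal)

/-- Membership in the homogeneous Besov space: `‖S_j f‖_{L_∞} → 0` as `j → -∞`, and the
homogeneous Besov norm is finite. -/
def MemBesov (χ φ : R3 → ℝ) (s : ℝ) (p q : ℝ≥0∞) (f : 𝓢'(R3, C3)) : Prop :=
  Tendsto (fun j : ℤ => distLpNorm ⊤ (dyadicCutoff χ j f)) atBot (𝓝 0) ∧
    besovNorm φ s p q f < ⊤

/-- `div f = ∑ᵢ ∂ᵢ fᵢ = 0` in the sense of tempered distributions. -/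
def IsDivFree (f : 𝓢'(R3, C3)) : Prop :=
  ∀ ψ : 𝓢(R3, ℂ), ∑ i : Fin 3, (∂_{(EuclideanSpace.single i (1 : ℝ) : R3)} f) ψ i = 0

/-- The distribution is real: it takes real values on real test functions. -/
def IsReal (f : 𝓢'(R3, C3)) : Prop :=
  ∀ ψ : 𝓢(R3, ℂ), (∀ x, (ψ x).im = 0) → ∀ i : Fin 3, (f ψ i).im = 0

/-- The critical regularity index `s_p = -1 + 3 / p`. -/
def critIndex (p : ℝ) : ℝ := -1 + 3 / p

end HomBesov

end

open HomBesov

/-!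
The argument truncates the dyadic blocks of `g` in physical space. With `p₂ = 2p`,
`δ = 1 / (4 (p - 2))` and a splitting frequency `2 ^ J` comparable to `N`, let `h_j` be the `j`-th
dyadic block of `g`, so that `‖h_j‖_p ≲ 2 ^ (j (1 - 3/p)) ‖g‖`. For `j ≥ J` the block is cut at the
height `‖g‖ 2 ^ (J + (j - J)(1 - 3δ))` into a tall part `b_j ∈ L_2` and a short part
`s_j ∈ L_{2p}`; for `j < J` nothing is cut and `b_j = 0`. The bounds
`‖b_j‖_2² ≤ t ^ (2 - p) ‖h_j‖_p ^ p` and `‖s_j‖_{2p}² ≤ t ‖h_j‖_p` for truncation at height `t`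
make the `L_2` norms of the tall parts and the weighted `L_{2p}` norms of the short parts decay
geometrically in `|j - J|`; below `2 ^ J` the latter comes from Bernstein's inequality
(`exists_block_splitting`, `regularWeight_of_lt`).

Truncation destroys both the frequency localization and the divergence-free condition. Both are
restored by `lerayBlock`, the multiplier with symbol `θ(2^{-j} ξ)(1 - ξ ⊗ ξ / |ξ|²)`, where `θ = 1`
on the support of the partition function. Its symbol is smooth with compact support away from the
origin, hence it is bounded on `L_p` uniformly in `j`, and it reproduces `h_j` because `div g = 0`
(`IsDivFree.lerayBlock_dyadicCutoff`). The irregular part is the series of the `lerayBlock θ j b_j`,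
which converges absolutely in `L_2`, and the regular part is what remains of `g`. Only five
projected blocks interact with a given dyadic block, so the Besov norms of both parts are
controlled block by block (`exists_decomposition`). The irregular part has no frequencies below
`2 ^ (J - 2)`, so the low frequency condition passes from `g` to both parts.

The function `φ` is not assumed even, so its dyadic blocks need not preserve real distributions.
Hence the blocks `h_j` are taken with respect to the even part of `φ`, which generates another
dyadic partition of unity; the bound on `‖h_j‖_p` follows because each such block is a
combination of neighbouring blocks with respect to `φ`.
-/

noncomputable section

namespace HomBesov

/-! ### Convolution inequalities -/

section Young

variable {G : Type*} [AddCommGroup G] [MeasurableSpace G] [MeasurableAdd₂ G] [MeasurableNeg G]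
  {μ : Measure G} [μ.IsAddLeftInvariant] [μ.IsNegInvariant]

/-- The `L_∞` bound `‖k * H‖_∞ ≤ ‖k‖_q ‖H‖_p` of a convolution. -/
theorem lintegral_conv_le_rpow_mul_rpow {p q : ℝ} (hpq : p.HolderConjugate q) {k H : G → ℝ≥0∞}
    (hk : Measurable k) (hH : AEMeasurable H μ) (x : G) :
    ∫⁻ y, k (x - y) * H y ∂μ ≤
      (∫⁻ y, k y ^ q ∂μ) ^ (1 / q) * (∫⁻ y, H y ^ p ∂μ) ^ (1 / p) := by
  have h := ENNReal.lintegral_mul_le_Lp_mul_Lq μ hpq.symm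
    (f := fun y => k (x - y)) (hk.comp (measurable_const.sub measurable_id)).aemeasurable hH
  rwa [lintegral_sub_left_eq_self (fun y => k y ^ q) x] at h

variable [SFinite μ]

/-- Young's inequality `‖k * H‖_p ≤ ‖k‖_1 ‖H‖_p`, raised to the power `p`. -/
theorem lintegral_conv_rpow_le {p : ℝ} (hp : 1 < p) {k H : G → ℝ≥0∞}
    (hk : Measurable k) (hH : AEMeasurable H μ) :
    ∫⁻ x, (∫⁻ y, k (x - y) * H y ∂μ) ^ p ∂μ ≤ (∫⁻ y, k y ∂μ) ^ p * ∫⁻ y, H y ^ p ∂μ := by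
  obtain ⟨q, hpq⟩ : ∃ q, p.HolderConjugate q := ⟨_, Real.HolderConjugate.conjExponent hp⟩
  have hp0 : 0 < p := hpq.pos
  have hq0 : 0 < q := hpq.symm.pos
  have hkx : ∀ x, Measurable fun y => k (x - y) := fun x =>
    hk.comp (measurable_const.sub measurable_id)
  have hexp : 1 / q + 1 / p = 1 := by
    have := hpq.inv_add_inv_eq_one; simp only [one_div]; linarith
  have hpoint : ∀ x, (∫⁻ y, k (x - y) * H y ∂μ) ^ p ≤
      (∫⁻ y, k y ∂μ) ^ (p / q) * ∫⁻ y, k (x - y) * H y ^ p ∂μ := by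
    intro x
    have h := ENNReal.lintegral_mul_le_Lp_mul_Lq μ hpq.symm
      (f := fun y => k (x - y) ^ (1 / q)) (g := fun y => k (x - y) ^ (1 / p) * H y)
      ((hkx x).pow_const _).aemeasurable (((hkx x).pow_const _).aemeasurable.mul hH)
    have e1 : ∀ y, ((fun y => k (x - y) ^ (1 / q)) * fun y => k (x - y) ^ (1 / p) * H y) y
        = k (x - y) * H y := by
      intro y
      simp only [Pi.mul_apply]
      rw [← mul_assoc, ← ENNReal.rpow_add_of_nonneg _ _ (by positivity) (by positivity), hexp,
        ENNReal.rpow_one]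
    have e2 : ∀ y, (k (x - y) ^ (1 / q)) ^ q = k (x - y) := by
      intro y
      rw [← ENNReal.rpow_mul, one_div_mul_cancel hq0.ne', ENNReal.rpow_one]
    have e3 : ∀ y, (k (x - y) ^ (1 / p) * H y) ^ p = k (x - y) * H y ^ p := by
      intro y
      rw [ENNReal.mul_rpow_of_nonneg _ _ hp0.le, ← ENNReal.rpow_mul,
        one_div_mul_cancel hp0.ne', ENNReal.rpow_one]
    simp only [e1, e2, e3] at h
    rw [lintegral_sub_left_eq_self k x] at h
    calc _ ≤ _ := ENNReal.rpow_le_rpow h hp0.le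
      _ = _ := by
        rw [ENNReal.mul_rpow_of_nonneg _ _ hp0.le, ← ENNReal.rpow_mul, ← ENNReal.rpow_mul,
          one_div_mul_cancel hp0.ne', ENNReal.rpow_one]
        congr 2
        field_simp
  have hmeas : AEMeasurable (Function.uncurry fun x y => k (x - y) * H y ^ p) (μ.prod μ) :=
    ((hk.comp (measurable_fst.sub measurable_snd)).aemeasurable).mul
      ((hH.pow_const p).comp_snd)
  calc _ ≤ ∫⁻ x, (∫⁻ y, k y ∂μ) ^ (p / q) * ∫⁻ y, k (x - y) * H y ^ p ∂μ ∂μ :=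
        lintegral_mono hpoint
    _ = (∫⁻ y, k y ∂μ) ^ (p / q) * ∫⁻ x, ∫⁻ y, k (x - y) * H y ^ p ∂μ ∂μ :=
        lintegral_const_mul'' _ hmeas.lintegral_prod_right'
    _ = (∫⁻ y, k y ∂μ) ^ (p / q) * ((∫⁻ y, k y ∂μ) * ∫⁻ y, H y ^ p ∂μ) := by
        rw [lintegral_lintegral_swap hmeas]
        congr 1
        rw [← lintegral_const_mul'' _ (hH.pow_const p)]
        refine lintegral_congr fun y => ?_
        have hky : Measurable fun x => k (x - y) := hk.comp (measurable_id.sub measurable_const)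
        rw [lintegral_mul_const _ hky, lintegral_sub_right_eq_self k y]
    _ = _ := by
        rw [← mul_assoc]
        congr 1
        nth_rewrite 2 [← ENNReal.rpow_one (∫⁻ y, k y ∂μ)]
        rw [← ENNReal.rpow_add_of_nonneg _ _ (by positivity) zero_le_one]
        congr 1
        have := hpq.sub_one_mul_conj
        field_simp
        linarith

/-- Interpolation between the `L_∞` bound and the `L_p` bound of a convolution. -/
theorem lintegral_conv_rpow_two_mul_le {p q : ℝ} (hpq : p.HolderConjugate q) {k H : G → ℝ≥0∞}
    (hk : Measurable k) (hH : AEMeasurable H μ) :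
    ∫⁻ x, (∫⁻ y, k (x - y) * H y ∂μ) ^ (2 * p) ∂μ ≤
      ((∫⁻ y, k y ^ q ∂μ) ^ (1 / q) * (∫⁻ y, H y ^ p ∂μ) ^ (1 / p)) ^ p *
        ((∫⁻ y, k y ∂μ) ^ p * ∫⁻ y, H y ^ p ∂μ) := by
  have hp0 : 0 < p := hpq.pos
  have hmeas : AEMeasurable (Function.uncurry fun x y => k (x - y) * H y) (μ.prod μ) :=
    ((hk.comp (measurable_fst.sub measurable_snd)).aemeasurable).mul hH.comp_snd
  calc _ ≤ ∫⁻ x, ((∫⁻ y, k y ^ q ∂μ) ^ (1 / q) * (∫⁻ y, H y ^ p ∂μ) ^ (1 / p)) ^ p *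
        (∫⁻ y, k (x - y) * H y ∂μ) ^ p ∂μ := by
        refine lintegral_mono fun x => ?_
        rw [two_mul, ENNReal.rpow_add_of_nonneg _ _ hp0.le hp0.le]
        gcongr
        exact lintegral_conv_le_rpow_mul_rpow hpq hk hH x
    _ = _ := lintegral_const_mul'' _ (hmeas.lintegral_prod_right'.pow_const p)
    _ ≤ _ := by
        gcongr
        exact lintegral_conv_rpow_le hpq.lt hk hH

end Young

/-! ### Kernels of dyadic Fourier multipliers -/

/-- The transpose of the multiplier with symbol `M`, applied to a test function, is an integral
operator whose kernel is the inverse Fourier transform of `M`. -/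
theorem fourier_smul_fourierInv_apply (M ψ : 𝓢(R3, ℂ)) (y : R3) :
    𝓕 (SchwartzMap.smulLeftCLM ℂ M (𝓕⁻ ψ)) y = ∫ x, ψ x * 𝓕⁻ (M : R3 → ℂ) (x - y) := by
  have h := VectorFourier.integral_fourierIntegral_smul_eq_flip (e := Real.fourierChar)
    (μ := (volume : Measure R3)) (ν := (volume : Measure R3)) (L := -innerₗ R3)
    (f := ψ) (g := fun ξ => Real.fourierChar (-(inner ℝ ξ y)) • M ξ)
    Real.continuous_fourierChar (by
      simp only [LinearMap.neg_apply, innerₗ_apply_apply]; fun_prop) ψ.integrable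
    ((Real.fourierIntegral_convergent_iff y).2 M.integrable)
  have hl : 𝓕 (SchwartzMap.smulLeftCLM ℂ M (𝓕⁻ ψ)) y = ∫ ξ, VectorFourier.fourierIntegral
      Real.fourierChar volume (-innerₗ R3) ψ ξ • (Real.fourierChar (-(inner ℝ ξ y)) • M ξ) := by
    rw [SchwartzMap.fourier_coe, Real.fourier_eq]
    refine integral_congr_ae (Eventually.of_forall fun ξ => ?_)
    simp only [SchwartzMap.smulLeftCLM_apply_apply M.hasTemperateGrowth, SchwartzMap.fourierInv_coe,
      smul_eq_mul, Circle.smul_def]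
    change _ = 𝓕⁻ (ψ : R3 → ℂ) ξ * _
    ring
  rw [hl, h]
  refine integral_congr_ae (Eventually.of_forall fun x => ?_)
  simp only [smul_eq_mul]
  congr 1
  rw [Real.fourierInv_eq]
  refine integral_congr_ae (Eventually.of_forall fun ξ => ?_)
  simp only [LinearMap.flip_apply, LinearMap.neg_apply, innerₗ_apply_apply, neg_neg, smul_smul,
    ← AddChar.map_add_eq_mul, inner_sub_right]
  rw [real_inner_comm ξ x, sub_eq_add_neg]

/-- The kernel of `m(2^{-j} D)` is the `L_1`-normalized dilate of the kernel of `m(D)`. -/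
theorem fourierInv_comp_two_zpow_smul (m : R3 → ℂ) (j : ℤ) (x : R3) :
    𝓕⁻ (fun ξ => m ((2 : ℝ) ^ (-j) • ξ)) x =
      (((2 : ℝ) ^ j) ^ 3 : ℝ) • 𝓕⁻ m ((2 : ℝ) ^ j • x) := by
  have h := Measure.integral_comp_smul (volume : Measure R3)
    (fun ξ => Real.fourierChar (inner ℝ ξ ((2 : ℝ) ^ j • x)) • m ξ) ((2 : ℝ) ^ (-j))
  rw [Real.fourierInv_eq, Real.fourierInv_eq]
  have e : |((((2 : ℝ) ^ (-j)) ^ Module.finrank ℝ R3))⁻¹| = ((2 : ℝ) ^ j) ^ 3 := by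
    rw [finrank_euclideanSpace_fin, zpow_neg, inv_pow, inv_inv, abs_of_pos (by positivity)]
  rw [e] at h
  rw [← h]
  refine integral_congr_ae (Eventually.of_forall fun ξ => ?_)
  simp only [inner_smul_left, inner_smul_right, RCLike.conj_to_real]
  rw [← mul_assoc, ← zpow_add₀ two_ne_zero]
  simp

theorem lintegral_comp_smul {r : ℝ} (hr : 0 < r) {F : R3 → ℝ≥0∞} (hF : Measurable F) :
    ENNReal.ofReal (r ^ 3) * ∫⁻ x, F (r • x) = ∫⁻ x, F x := by
  have h := Measure.map_addHaar_smul (volume : Measure R3) hr.ne'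
  have h2 : ∫⁻ x, F (r • x) = ∫⁻ x, F x ∂(Measure.map (fun x => r • x) volume) :=
    (lintegral_map hF (measurable_const_smul r)).symm
  rw [h2, h, lintegral_smul_measure, smul_eq_mul, ← mul_assoc, finrank_euclideanSpace_fin,
    ← ENNReal.ofReal_mul (by positivity), abs_of_pos (by positivity),
    mul_inv_cancel₀ (by positivity), ENNReal.ofReal_one, one_mul]

/-- The dilate `m(2^{-j} ξ)` of a real symbol, as a complex-valued Schwartz function. -/
def dilatedSymbol {m : R3 → ℝ} (hm : ContDiff ℝ ∞ m) (hc : HasCompactSupport m) (j : ℤ) :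
    𝓢(R3, ℂ) :=
  HasCompactSupport.toSchwartzMap (f := fun ξ : R3 => ((m ((2 : ℝ) ^ (-j) • ξ) : ℝ) : ℂ))
    ((hc.comp_smul (by positivity)).comp_left Complex.ofReal_zero)
    (Complex.ofRealCLM.contDiff.comp (hm.comp (contDiff_const_smul _)))

/-- The convolution kernel of the dyadic multiplier `dyadicCutoff m j`. -/
def dyadicKernel (m : R3 → ℝ) (j : ℤ) : R3 → ℂ :=
  𝓕⁻ fun ξ => ((m ((2 : ℝ) ^ (-j) • ξ) : ℝ) : ℂ)

theorem dyadicKernel_eq_fourierInv {m : R3 → ℝ} (hm : ContDiff ℝ ∞ m) (hc : HasCompactSupport m)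
    (j : ℤ) : dyadicKernel m j = (𝓕⁻ (dilatedSymbol hm hc j) : 𝓢(R3, ℂ)) := by
  rw [SchwartzMap.fourierInv_coe]; rfl

theorem continuous_dyadicKernel {m : R3 → ℝ} (hm : ContDiff ℝ ∞ m) (hc : HasCompactSupport m)
    (j : ℤ) : Continuous (dyadicKernel m j) := by
  rw [dyadicKernel_eq_fourierInv hm hc]; exact SchwartzMap.continuous _

theorem dyadicKernel_eq_smul (m : R3 → ℝ) (j : ℤ) (x : R3) :
    dyadicKernel m j x = (((2 : ℝ) ^ j) ^ 3 : ℝ) • dyadicKernel m 0 ((2 : ℝ) ^ j • x) := by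
  have := fourierInv_comp_two_zpow_smul (fun ξ => (m ξ : ℂ)) j x
  simpa [dyadicKernel] using this

theorem lintegral_enorm_dyadicKernel_rpow {m : R3 → ℝ} (hm : ContDiff ℝ ∞ m)
    (hc : HasCompactSupport m) (j : ℤ) {q : ℝ} (hq : 0 ≤ q) :
    ∫⁻ x, ‖dyadicKernel m j x‖ₑ ^ q =
      ENNReal.ofReal ((2 : ℝ) ^ (3 * (j : ℝ) * (q - 1))) * ∫⁻ x, ‖dyadicKernel m 0 x‖ₑ ^ q := by
  have hmeas : Measurable fun x => ‖dyadicKernel m 0 x‖ₑ ^ q :=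
    ((continuous_dyadicKernel hm hc 0).enorm.measurable).pow_const q
  have h2 : (0 : ℝ) < (2 : ℝ) ^ j := by positivity
  rw [← lintegral_comp_smul h2 hmeas, ← mul_assoc, ← ENNReal.ofReal_mul (by positivity)]
  have hcoef : ((2 : ℝ) ^ (3 * (j : ℝ) * (q - 1))) * ((2 : ℝ) ^ j) ^ 3
      = (((2 : ℝ) ^ j) ^ 3) ^ q := by
    rw [← Real.rpow_intCast 2 j, ← Real.rpow_natCast, ← Real.rpow_mul zero_le_two,
      ← Real.rpow_mul zero_le_two, ← Real.rpow_add zero_lt_two]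
    congr 1; push_cast; ring
  have hmeas' : Measurable fun x => ‖dyadicKernel m 0 ((2 : ℝ) ^ j • x)‖ₑ ^ q :=
    hmeas.comp (measurable_const_smul _)
  rw [hcoef, ← lintegral_const_mul _ hmeas']
  refine lintegral_congr fun x => ?_
  rw [dyadicKernel_eq_smul, enorm_smul, ENNReal.mul_rpow_of_nonneg _ _ hq,
    Real.enorm_of_nonneg (by positivity), ENNReal.ofReal_rpow_of_nonneg (by positivity) hq]

theorem lintegral_enorm_dyadicKernel_rpow_lt_top {m : R3 → ℝ} (hm : ContDiff ℝ ∞ m)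
    (hc : HasCompactSupport m) (j : ℤ) {q : ℝ} (hq : 1 ≤ q) :
    ∫⁻ x, ‖dyadicKernel m j x‖ₑ ^ q < ⊤ := by
  have h := (𝓕⁻ (dilatedSymbol hm hc j) : 𝓢(R3, ℂ)).eLpNorm_lt_top (ENNReal.ofReal q) volume
  rw [← dyadicKernel_eq_fourierInv] at h
  have hq0 : 0 < q := by linarith
  have := lintegral_rpow_enorm_lt_top_of_eLpNorm_lt_top (by simpa using hq0) (by simp) h
  rwa [ENNReal.toReal_ofReal hq0.le] at this

/-- `h` is a function that represents the distribution `f`. -/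
def Represents (h : R3 → C3) (f : 𝓢'(R3, C3)) : Prop :=
  ∀ ψ : 𝓢(R3, ℂ), f ψ = ∫ x, ψ x • h x

theorem dyadicCutoff_apply {m : R3 → ℝ} (hm : ContDiff ℝ ∞ m) (hc : HasCompactSupport m) (j : ℤ)
    (f : 𝓢'(R3, C3)) (ψ : 𝓢(R3, ℂ)) :
    dyadicCutoff m j f ψ =
      f (𝓕 (SchwartzMap.smulLeftCLM ℂ (dilatedSymbol hm hc j) (𝓕⁻ ψ))) := rfl

theorem dyadicCutoff_transpose_apply {m : R3 → ℝ} (hm : ContDiff ℝ ∞ m) (hc : HasCompactSupport m)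
    (j : ℤ) (ψ : 𝓢(R3, ℂ)) (y : R3) :
    𝓕 (SchwartzMap.smulLeftCLM ℂ (dilatedSymbol hm hc j) (𝓕⁻ ψ)) y =
      ∫ x, ψ x * dyadicKernel m j (x - y) :=
  fourier_smul_fourierInv_apply _ _ _

theorem lintegral_enorm_rpow_lt_top {p : ℝ} (hp : 0 < p) {h : R3 → C3}
    (hh : MemLp h (ENNReal.ofReal p) volume) : ∫⁻ x, ‖h x‖ₑ ^ p < ⊤ := by
  have := lintegral_rpow_enorm_lt_top_of_eLpNorm_lt_top (by simpa using hp) (by simp) hh.2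
  rwa [ENNReal.toReal_ofReal hp.le] at this

/-- On `L_p` functions, `1 < p < ∞`, a dyadic multiplier acts by convolution with its kernel. -/
theorem Represents.dyadicCutoff {m : R3 → ℝ} (hm : ContDiff ℝ ∞ m) (hc : HasCompactSupport m)
    (j : ℤ) {p : ℝ} (hp : 1 < p) {h : R3 → C3} (hh : MemLp h (ENNReal.ofReal p) volume)
    {f : 𝓢'(R3, C3)} (hf : Represents h f) :
    Represents (fun x => ∫ y, dyadicKernel m j (x - y) • h y) (dyadicCutoff m j f) := by
  intro ψ
  obtain ⟨q, hpq⟩ : ∃ q, p.HolderConjugate q := ⟨_, Real.HolderConjugate.conjExponent hp⟩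
  have hK := continuous_dyadicKernel hm hc j
  rw [dyadicCutoff_apply hm hc, hf]
  simp_rw [dyadicCutoff_transpose_apply, ← integral_smul_const, ← integral_smul, smul_smul]
  refine (integral_integral_swap ?_).symm
  set B : ℝ≥0∞ := (∫⁻ y, ‖dyadicKernel m j y‖ₑ ^ q) ^ (1 / q) *
    (∫⁻ y : R3, ‖h y‖ₑ ^ p) ^ (1 / p) with hB
  have hBtop : B < ⊤ := ENNReal.mul_lt_top
    (ENNReal.rpow_lt_top_of_nonneg (by simpa using hpq.symm.nonneg)
      (lintegral_enorm_dyadicKernel_rpow_lt_top hm hc j hpq.symm.lt.le).ne)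
    (ENNReal.rpow_lt_top_of_nonneg (by simpa using hpq.nonneg)
      (lintegral_enorm_rpow_lt_top hpq.pos hh).ne)
  have hmeas : AEStronglyMeasurable
      (Function.uncurry fun x y => (ψ x * dyadicKernel m j (x - y)) • h y)
      ((volume : Measure R3).prod volume) := by
    have h2 : AEStronglyMeasurable (fun z : R3 × R3 => h z.2) (volume.prod volume) := hh.1.comp_snd
    have h1 : Continuous fun z : R3 × R3 => ψ z.1 * dyadicKernel m j (z.1 - z.2) :=
      (ψ.continuous.comp continuous_fst).mul (hK.comp (continuous_fst.sub continuous_snd))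
    exact h1.aestronglyMeasurable.smul h2
  refine ⟨hmeas, ?_⟩
  rw [hasFiniteIntegral_iff_enorm, lintegral_prod _ hmeas.enorm]
  calc _ ≤ ∫⁻ x, ‖ψ x‖ₑ * B := by
        refine lintegral_mono fun x => ?_
        simp only [Function.uncurry_apply_pair, enorm_smul, enorm_mul, mul_assoc]
        rw [lintegral_const_mul' _ _ enorm_ne_top]
        gcongr
        exact lintegral_conv_le_rpow_mul_rpow hpq (k := fun y => ‖dyadicKernel m j y‖ₑ)
          hK.enorm.measurable hh.1.enorm x
    _ = (∫⁻ x, ‖ψ x‖ₑ) * B := lintegral_mul_const' _ _ hBtop.ne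
    _ < ⊤ := ENNReal.mul_lt_top ψ.integrable.2 hBtop

/-! ### The `L_p` norm of a tempered distribution -/

theorem Represents.distLpNorm_le {p : ℝ≥0∞} {h : R3 → C3} {f : 𝓢'(R3, C3)} (hf : Represents h f)
    (hh : MemLp h p volume) : distLpNorm p f ≤ eLpNorm h p volume :=
  iInf_le_of_le h (iInf_le_of_le hh (iInf_le_of_le hf le_rfl))

theorem exists_represents_of_distLpNorm_lt {p : ℝ≥0∞} {f : 𝓢'(R3, C3)} {c : ℝ≥0∞}
    (hc : distLpNorm p f < c) :
    ∃ h : R3 → C3, MemLp h p volume ∧ Represents h f ∧ eLpNorm h p volume < c := by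
  simp only [distLpNorm, iInf_lt_iff] at hc
  obtain ⟨h, hh, hf, hlt⟩ := hc
  exact ⟨h, hh, hf, hlt⟩

theorem represents_toTemperedDistribution {p : ℝ≥0∞} [Fact (1 ≤ p)]
    (u : Lp C3 p (volume : Measure R3)) : Represents u (u : 𝓢'(R3, C3)) := fun ψ =>
  Lp.toTemperedDistribution_apply u ψ

theorem distLpNorm_toTemperedDistribution_le {p : ℝ≥0∞} [Fact (1 ≤ p)]
    (u : Lp C3 p (volume : Measure R3)) : distLpNorm p (u : 𝓢'(R3, C3)) ≤ ‖u‖ₑ := by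
  refine ((represents_toTemperedDistribution u).distLpNorm_le (Lp.memLp u)).trans_eq ?_
  exact (Lp.enorm_def u).symm

theorem Represents.eq_toTemperedDistribution {p : ℝ≥0∞} [Fact (1 ≤ p)] {h : R3 → C3}
    {f : 𝓢'(R3, C3)} (hf : Represents h f) (hh : MemLp h p volume) :
    f = ((hh.toLp h : Lp C3 p volume) : 𝓢'(R3, C3)) := by
  ext1 ψ
  rw [hf ψ, Lp.toTemperedDistribution_apply]
  refine integral_congr_ae ?_
  filter_upwards [hh.coeFn_toLp] with x hx
  rw [hx]

theorem exists_toTemperedDistribution_eq_of_distLpNorm_lt {p : ℝ≥0∞} [Fact (1 ≤ p)]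
    {f : 𝓢'(R3, C3)} {c : ℝ≥0∞} (hc : distLpNorm p f < c) :
    ∃ u : Lp C3 p (volume : Measure R3), f = (u : 𝓢'(R3, C3)) ∧ ‖u‖ₑ < c := by
  obtain ⟨h, hh, hf, hlt⟩ := exists_represents_of_distLpNorm_lt hc
  exact ⟨hh.toLp h, hf.eq_toTemperedDistribution hh, by rwa [Lp.enorm_toLp]⟩

theorem distLpNorm_zero {p : ℝ≥0∞} : distLpNorm p 0 = 0 := by
  refine le_antisymm ?_ (zero_le)
  have : Represents (0 : R3 → C3) 0 := fun ψ => by simp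
  simpa using this.distLpNorm_le (p := p) MemLp.zero

theorem distLpNorm_add_le {p : ℝ≥0∞} [hp : Fact (1 ≤ p)] (f g : 𝓢'(R3, C3)) :
    distLpNorm p (f + g) ≤ distLpNorm p f + distLpNorm p g := by
  refine ENNReal.le_of_forall_pos_le_add fun ε hε hlt => ?_
  have hε2 : (0 : ℝ≥0∞) < (ε / 2 : ℝ≥0) := by exact_mod_cast half_pos hε
  have hf : distLpNorm p f < ⊤ := lt_of_le_of_lt le_self_add hlt
  have hg : distLpNorm p g < ⊤ := lt_of_le_of_lt le_add_self hlt
  obtain ⟨u, rfl, hu⟩ := exists_toTemperedDistribution_eq_of_distLpNorm_lt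
    (ENNReal.lt_add_right hf.ne hε2.ne')
  obtain ⟨v, rfl, hv⟩ := exists_toTemperedDistribution_eq_of_distLpNorm_lt
    (ENNReal.lt_add_right hg.ne hε2.ne')
  have e : (u : 𝓢'(R3, C3)) + (v : 𝓢'(R3, C3)) = ((u + v : Lp C3 p volume) : 𝓢'(R3, C3)) :=
    ((Lp.toTemperedDistributionCLM C3 (volume : Measure R3) p).map_add u v).symm
  rw [e]
  calc _ ≤ ‖u + v‖ₑ := distLpNorm_toTemperedDistribution_le _
    _ ≤ ‖u‖ₑ + ‖v‖ₑ := enorm_add_le _ _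
    _ ≤ _ := add_le_add hu.le hv.le
    _ = _ := by
      rw [add_add_add_comm, ← ENNReal.coe_add, add_halves]

theorem distLpNorm_sum_le {ι : Type*} {p : ℝ≥0∞} [Fact (1 ≤ p)] (s : Finset ι)
    (f : ι → 𝓢'(R3, C3)) : distLpNorm p (∑ i ∈ s, f i) ≤ ∑ i ∈ s, distLpNorm p (f i) :=
  Finset.le_sum_of_subadditive _ distLpNorm_zero.le (fun f g => distLpNorm_add_le f g) s f

theorem integrable_smul_of_memLp {p : ℝ≥0∞} (hp : 1 ≤ p) {h : R3 → C3} (hh : MemLp h p volume)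
    (ψ : 𝓢(R3, ℂ)) : Integrable (fun x => ψ x • h x) (volume : Measure R3) := by
  have := ENNReal.HolderConjugate.inv_one_sub_inv' hp
  exact memLp_one_iff_integrable.1 (hh.smul (ψ.memLp (1 - p⁻¹)⁻¹ volume) (r := 1))

/-- Composition of a vector-valued distribution with a linear map of the values. -/
def mapValues (A : C3 →L[ℂ] C3) : 𝓢'(R3, C3) →L[ℂ] 𝓢'(R3, C3) :=
  PointwiseConvergenceCLM.postcomp _ A

@[simp]
theorem mapValues_apply (A : C3 →L[ℂ] C3) (f : 𝓢'(R3, C3)) (ψ : 𝓢(R3, ℂ)) :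
    mapValues A f ψ = A (f ψ) := rfl

theorem distLpNorm_mapValues_le {p : ℝ≥0∞} [Fact (1 ≤ p)] {A : C3 →L[ℂ] C3} (hA : ‖A‖ ≤ 1)
    (f : 𝓢'(R3, C3)) : distLpNorm p (mapValues A f) ≤ distLpNorm p f := by
  refine le_of_forall_gt fun c hc => ?_
  obtain ⟨u, rfl, hu⟩ := exists_toTemperedDistribution_eq_of_distLpNorm_lt hc
  have e : mapValues A (u : 𝓢'(R3, C3)) = (A.compLp u : Lp C3 p volume) := by
    ext1 ψ
    have hint := integrable_smul_of_memLp Fact.out (Lp.memLp u) ψ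
    rw [mapValues_apply, Lp.toTemperedDistribution_apply, Lp.toTemperedDistribution_apply,
      ← A.integral_comp_comm hint]
    refine integral_congr_ae ?_
    filter_upwards [A.coeFn_compLp u] with x hx
    rw [hx, map_smul]
  rw [e]
  refine lt_of_le_of_lt ((distLpNorm_toTemperedDistribution_le _).trans ?_) hu
  rw [enorm_le_iff_norm_le]
  exact (A.norm_compLp_le u).trans (mul_le_of_le_one_left (norm_nonneg _) hA)

/-! ### Bounds for dyadic multipliers, uniform in the dyadic index -/

theorem eLpNorm_ofReal {p : ℝ} (hp : 0 < p) (h : R3 → C3) :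
    eLpNorm h (ENNReal.ofReal p) volume = (∫⁻ x, ‖h x‖ₑ ^ p) ^ (1 / p) := by
  rw [eLpNorm_eq_lintegral_rpow_enorm_toReal (by simpa using hp) (by simp),
    ENNReal.toReal_ofReal hp.le]

theorem aestronglyMeasurable_conv {K : R3 → ℂ} (hK : Continuous K) {h : R3 → C3}
    (hh : AEStronglyMeasurable h volume) :
    AEStronglyMeasurable (fun x => ∫ y, K (x - y) • h y) (volume : Measure R3) := by
  have h2 : AEStronglyMeasurable (fun z : R3 × R3 => h z.2) (volume.prod volume) := hh.comp_snd
  have h1 : Continuous fun z : R3 × R3 => K (z.1 - z.2) :=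
    hK.comp (continuous_fst.sub continuous_snd)
  exact (h1.aestronglyMeasurable.smul h2).integral_prod_right'

theorem enorm_conv_le (K : R3 → ℂ) (h : R3 → C3) (x : R3) :
    ‖∫ y, K (x - y) • h y‖ₑ ≤ ∫⁻ y, ‖K (x - y)‖ₑ * ‖h y‖ₑ := by
  refine (enorm_integral_le_lintegral_enorm _).trans_eq ?_
  simp_rw [enorm_smul]

/-- Bounds of the form `X ≤ A ‖f‖_p` may be checked on representatives; if there are none, the
right-hand side is infinite, which is why `A` must not vanish. -/
theorem le_mul_distLpNorm {p : ℝ≥0∞} {f : 𝓢'(R3, C3)} {A X : ℝ≥0∞} (hA : A ≠ 0) (hA' : A ≠ ⊤)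
    (H : ∀ h : R3 → C3, MemLp h p volume → Represents h f → X ≤ A * eLpNorm h p volume) :
    X ≤ A * distLpNorm p f := by
  simp only [distLpNorm, ENNReal.mul_iInf_of_ne hA hA']
  exact le_iInf fun h => le_iInf fun hh => le_iInf fun hf => H h hh hf

/-- Dyadic multipliers are bounded on `L_p`, uniformly in the dyadic index. -/
theorem exists_distLpNorm_dyadicCutoff_le {m : R3 → ℝ} (hm : ContDiff ℝ ∞ m)
    (hc : HasCompactSupport m) :
    ∃ A : ℝ≥0, ∀ (p : ℝ), 1 < p → ∀ (j : ℤ) (f : 𝓢'(R3, C3)),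
      distLpNorm (ENNReal.ofReal p) (dyadicCutoff m j f) ≤
        A * distLpNorm (ENNReal.ofReal p) f := by
  have hAtop := lintegral_enorm_dyadicKernel_rpow_lt_top hm hc 0 le_rfl
  refine ⟨(∫⁻ x, ‖dyadicKernel m 0 x‖ₑ ^ (1 : ℝ)).toNNReal + 1, fun p hp j f => ?_⟩
  have hp0 : 0 < p := by linarith
  refine le_mul_distLpNorm (by simp) (by simp) fun h hh hf => ?_
  rw [ENNReal.coe_add, ENNReal.coe_toNNReal hAtop.ne]
  have hK := continuous_dyadicKernel hm hc j
  have hbound : eLpNorm (fun x => ∫ y, dyadicKernel m j (x - y) • h y) (ENNReal.ofReal p) volume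
      ≤ (∫⁻ x, ‖dyadicKernel m 0 x‖ₑ ^ (1 : ℝ)) * eLpNorm h (ENNReal.ofReal p) volume := by
    rw [eLpNorm_ofReal hp0, eLpNorm_ofReal hp0]
    calc _ ≤ ((∫⁻ y, ‖dyadicKernel m j y‖ₑ) ^ p * ∫⁻ y, ‖h y‖ₑ ^ p) ^ (1 / p) := by
          refine ENNReal.rpow_le_rpow ?_ (by positivity)
          refine le_trans (lintegral_mono fun x => ?_) (lintegral_conv_rpow_le hp
            (k := fun y => ‖dyadicKernel m j y‖ₑ) hK.enorm.measurable hh.1.enorm)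
          exact ENNReal.rpow_le_rpow (enorm_conv_le _ _ _) hp0.le
      _ = _ := by
          rw [ENNReal.mul_rpow_of_nonneg _ _ (by positivity), ← ENNReal.rpow_mul,
            mul_one_div_cancel hp0.ne', ENNReal.rpow_one]
          have := lintegral_enorm_dyadicKernel_rpow hm hc j zero_le_one
          simp only [sub_self, mul_zero, Real.rpow_zero, ENNReal.ofReal_one, one_mul] at this
          rw [← this]
          simp only [ENNReal.rpow_one]
  have hmem : MemLp (fun x => ∫ y, dyadicKernel m j (x - y) • h y) (ENNReal.ofReal p) volume :=
    ⟨aestronglyMeasurable_conv hK hh.1, hbound.trans_lt (ENNReal.mul_lt_top hAtop hh.2)⟩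
  refine ((hf.dyadicCutoff hm hc j hp hh).distLpNorm_le hmem).trans (hbound.trans ?_)
  gcongr
  exact le_self_add

/-- Bernstein's inequality: dyadic multipliers map `L_p` to `L_{2p}`, and the norm grows
like `2 ^ (3 j / (2 p))`. -/
theorem exists_distLpNorm_two_mul_dyadicCutoff_le {m : R3 → ℝ} (hm : ContDiff ℝ ∞ m)
    (hc : HasCompactSupport m) {p : ℝ} (hp : 1 < p) :
    ∃ A : ℝ≥0, ∀ (j : ℤ) (f : 𝓢'(R3, C3)),
      distLpNorm (ENNReal.ofReal (2 * p)) (dyadicCutoff m j f) ≤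
        A * ENNReal.ofReal ((2 : ℝ) ^ (3 * (j : ℝ) / (2 * p))) *
          distLpNorm (ENNReal.ofReal p) f := by
  obtain ⟨q, hpq⟩ : ∃ q, p.HolderConjugate q := ⟨_, Real.HolderConjugate.conjExponent hp⟩
  have hp0 : 0 < p := by linarith
  have hq0 : 0 < q := hpq.symm.pos
  have hAtop := lintegral_enorm_dyadicKernel_rpow_lt_top hm hc 0 le_rfl
  have hBtop := lintegral_enorm_dyadicKernel_rpow_lt_top hm hc 0 hpq.symm.lt.le
  set A := ∫⁻ x, ‖dyadicKernel m 0 x‖ₑ ^ (1 : ℝ) with hA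
  set B := ∫⁻ x, ‖dyadicKernel m 0 x‖ₑ ^ q with hB
  set D : ℝ≥0∞ := (B ^ (1 / q) * A) ^ (1 / 2 : ℝ) with hD
  have hDtop : D < ⊤ := ENNReal.rpow_lt_top_of_nonneg (by norm_num) (ENNReal.mul_lt_top
    (ENNReal.rpow_lt_top_of_nonneg (by positivity) hBtop.ne) hAtop).ne
  refine ⟨D.toNNReal + 1, fun j f => ?_⟩
  set r : ℝ≥0∞ := ENNReal.ofReal ((2 : ℝ) ^ (3 * (j : ℝ) / (2 * p))) with hr
  have hr0 : r ≠ 0 := by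
    rw [hr, ne_eq, ENNReal.ofReal_eq_zero, not_le]; positivity
  have hrtop : r ≠ ⊤ := ENNReal.ofReal_ne_top
  refine le_mul_distLpNorm (mul_ne_zero (by simp) hr0) (ENNReal.mul_ne_top (by simp) hrtop)
    fun h hh hf => ?_
  rw [ENNReal.coe_add, ENNReal.coe_toNNReal hDtop.ne]
  have hK := continuous_dyadicKernel hm hc j
  have hbound : eLpNorm (fun x => ∫ y, dyadicKernel m j (x - y) • h y) (ENNReal.ofReal (2 * p))
      volume ≤ D * r * eLpNorm h (ENNReal.ofReal p) volume := by
    rw [eLpNorm_ofReal hp0, eLpNorm_ofReal (by positivity)]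
    have e1 : ∫⁻ y, ‖dyadicKernel m j y‖ₑ = A := by
      have := lintegral_enorm_dyadicKernel_rpow hm hc j zero_le_one
      simp only [sub_self, mul_zero, Real.rpow_zero, ENNReal.ofReal_one, one_mul] at this
      simpa only [ENNReal.rpow_one, hA] using this
    have e2 : (∫⁻ y, ‖dyadicKernel m j y‖ₑ ^ q) ^ (1 / q) = r ^ (2 : ℝ) * B ^ (1 / q) := by
      rw [lintegral_enorm_dyadicKernel_rpow hm hc j hq0.le,
        ENNReal.mul_rpow_of_nonneg _ _ (by positivity),
        ENNReal.ofReal_rpow_of_nonneg (by positivity) (by positivity), hr,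
        ENNReal.ofReal_rpow_of_nonneg (by positivity) (by positivity),
        ← Real.rpow_mul zero_le_two, ← Real.rpow_mul zero_le_two]
      congr 3
      have := hpq.symm.sub_one_mul_conj
      field_simp
      linear_combination (j : ℝ) * this
    calc _ ≤ ((r ^ (2 : ℝ) * B ^ (1 / q) * (∫⁻ y, ‖h y‖ₑ ^ p) ^ (1 / p)) ^ p *
            (A ^ p * ∫⁻ y, ‖h y‖ₑ ^ p)) ^ (1 / (2 * p)) := by
          refine ENNReal.rpow_le_rpow ?_ (by positivity)
          rw [← e1, ← e2]
          refine le_trans (lintegral_mono fun x => ?_) (lintegral_conv_rpow_two_mul_le hpq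
            (k := fun y => ‖dyadicKernel m j y‖ₑ) hK.enorm.measurable hh.1.enorm)
          exact ENNReal.rpow_le_rpow (enorm_conv_le _ _ _) (by positivity)
      _ = ((r ^ (2 : ℝ) * (B ^ (1 / q) * A) * ((∫⁻ y, ‖h y‖ₑ ^ p) ^ (1 / p)) ^ (2 : ℝ)) ^ p)
            ^ (1 / (2 * p)) := by
          congr 1
          set H := ∫⁻ y, ‖h y‖ₑ ^ p
          have : H = (H ^ (1 / p)) ^ p := by
            rw [← ENNReal.rpow_mul, one_div_mul_cancel hp0.ne', ENNReal.rpow_one]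
          nth_rewrite 2 [this]
          rw [← ENNReal.mul_rpow_of_nonneg _ _ hp0.le, ← ENNReal.mul_rpow_of_nonneg _ _ hp0.le]
          congr 1
          rw [ENNReal.rpow_two (H ^ (1 / p)), sq]
          ring
      _ = _ := by
          rw [← ENNReal.rpow_mul, show p * (1 / (2 * p)) = 1 / 2 by field_simp,
            ENNReal.mul_rpow_of_nonneg _ _ (by norm_num),
            ENNReal.mul_rpow_of_nonneg _ _ (by norm_num), ← ENNReal.rpow_mul, ← ENNReal.rpow_mul,
            show (2 : ℝ) * (1 / 2) = 1 by norm_num, ENNReal.rpow_one, ENNReal.rpow_one,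
            mul_comm r]
  have hmem : MemLp (fun x => ∫ y, dyadicKernel m j (x - y) • h y) (ENNReal.ofReal (2 * p))
      volume := ⟨aestronglyMeasurable_conv hK hh.1, hbound.trans_lt
        (ENNReal.mul_lt_top (ENNReal.mul_lt_top hDtop hrtop.lt_top) hh.2)⟩
  refine ((hf.dyadicCutoff hm hc j hp hh).distLpNorm_le hmem).trans (hbound.trans ?_)
  gcongr
  exact le_self_add

/-! ### Annular symbols and products of dyadic multipliers -/

/-- A smooth real symbol whose support lies in `{r ≤ ‖ξ‖ ≤ R}`. With `r = 0` it is a smooth symbol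
supported in a ball. -/
structure IsAnnularSymbol (m : R3 → ℝ) (r R : ℝ) : Prop where
  smooth : ContDiff ℝ ∞ m
  lower : ∀ ξ, m ξ ≠ 0 → r ≤ ‖ξ‖
  upper : ∀ ξ, m ξ ≠ 0 → ‖ξ‖ ≤ R

namespace IsAnnularSymbol

variable {m n : R3 → ℝ} {r R r' R' : ℝ}

theorem hasCompactSupport (hm : IsAnnularSymbol m r R) : HasCompactSupport m :=
  HasCompactSupport.of_support_subset_isCompact (isCompact_closedBall 0 R) fun ξ hξ => by
    simpa using hm.upper ξ hξ

theorem hasTemperateGrowth (hm : IsAnnularSymbol m r R) (j : ℤ) :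
    Function.HasTemperateGrowth fun ξ : R3 => ((m ((2 : ℝ) ^ (-j) • ξ) : ℝ) : ℂ) :=
  (dilatedSymbol hm.smooth hm.hasCompactSupport j).hasTemperateGrowth

theorem le_norm_of_comp_ne_zero (hm : IsAnnularSymbol m r R) {j : ℤ} {ξ : R3}
    (h : m ((2 : ℝ) ^ (-j) • ξ) ≠ 0) : r * 2 ^ j ≤ ‖ξ‖ := by
  have := hm.lower _ h
  rwa [norm_smul, zpow_neg, norm_inv, Real.norm_of_nonneg (by positivity), inv_mul_eq_div,
    le_div_iff₀ (by positivity)] at this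

theorem norm_le_of_comp_ne_zero (hm : IsAnnularSymbol m r R) {j : ℤ} {ξ : R3}
    (h : m ((2 : ℝ) ^ (-j) • ξ) ≠ 0) : ‖ξ‖ ≤ R * 2 ^ j := by
  have := hm.upper _ h
  rwa [norm_smul, zpow_neg, norm_inv, Real.norm_of_nonneg (by positivity), inv_mul_eq_div,
    div_le_iff₀ (by positivity)] at this

/-- If two dilated annular symbols are both nonzero at a frequency, then the dyadic index of the
second one is controlled by that of the first one. -/
theorem index_lt (hm : IsAnnularSymbol m r R) (hn : IsAnnularSymbol n r' R') (hr' : 0 < r')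
    {c : ℤ} (hc : R < r' * 2 ^ c) {k j : ℤ} {ξ : R3} (h1 : m ((2 : ℝ) ^ (-k) • ξ) ≠ 0)
    (h2 : n ((2 : ℝ) ^ (-j) • ξ) ≠ 0) : j < k + c := by
  by_contra! hle
  have h3 : (2 : ℝ) ^ (k + c) ≤ 2 ^ j := zpow_le_zpow_right₀ one_le_two hle
  rw [zpow_add₀ two_ne_zero] at h3
  have h4 := (hn.le_norm_of_comp_ne_zero h2).trans (hm.norm_le_of_comp_ne_zero h1)
  have h5 : (0 : ℝ) < 2 ^ k := by positivity
  have h6 := mul_le_mul_of_nonneg_left h3 hr'.le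
  have h7 := mul_lt_mul_of_pos_right hc h5
  nlinarith

theorem mul (hm : IsAnnularSymbol m r R) {F : R3 → ℝ} (hr : 0 < r)
    (hF : ∀ ξ, ξ ≠ 0 → ContDiffAt ℝ ∞ F ξ) : IsAnnularSymbol (fun ξ => m ξ * F ξ) r R where
  smooth := by
    rw [contDiff_iff_contDiffAt]
    intro ξ
    by_cases hξ : ξ = 0
    · subst hξ
      have : (fun ξ => m ξ * F ξ) =ᶠ[𝓝 0] fun _ => 0 := by
        filter_upwards [Metric.ball_mem_nhds (0 : R3) hr] with ξ hξ
        rw [mem_ball_zero_iff] at hξ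
        have : m ξ = 0 := by
          by_contra h
          exact absurd (hm.lower ξ h) (not_le.2 hξ)
        simp [this]
      exact contDiffAt_const.congr_of_eventuallyEq this
    · exact hm.smooth.contDiffAt.mul (hF ξ hξ)
  lower ξ h := hm.lower ξ (left_ne_zero_of_mul h)
  upper ξ h := hm.upper ξ (left_ne_zero_of_mul h)

end IsAnnularSymbol

theorem dyadicCutoff_dyadicCutoff {m n : R3 → ℝ} {r R r' R' : ℝ} (hm : IsAnnularSymbol m r R)
    (hn : IsAnnularSymbol n r' R') (k j : ℤ) (f : 𝓢'(R3, C3)) :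
    dyadicCutoff m k (dyadicCutoff n j f) = TemperedDistribution.fourierMultiplierCLM C3
      (fun ξ : R3 => ((n ((2 : ℝ) ^ (-j) • ξ) * m ((2 : ℝ) ^ (-k) • ξ) : ℝ) : ℂ)) f := by
  unfold dyadicCutoff
  rw [TemperedDistribution.fourierMultiplierCLM_fourierMultiplierCLM_apply
    (hn.hasTemperateGrowth j) (hm.hasTemperateGrowth k)]
  congr 1
  congr 1
  ext ξ
  simp

theorem fourierMultiplierCLM_zero (f : 𝓢'(R3, C3)) :
    TemperedDistribution.fourierMultiplierCLM C3 (fun _ : R3 => (0 : ℂ)) f = 0 := by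
  rw [TemperedDistribution.fourierMultiplierCLM_const]; simp

theorem dyadicCutoff_dyadicCutoff_eq_zero {m n : R3 → ℝ} {r R r' R' : ℝ}
    (hm : IsAnnularSymbol m r R) (hn : IsAnnularSymbol n r' R') {k j : ℤ}
    (h : ∀ ξ, m ((2 : ℝ) ^ (-k) • ξ) ≠ 0 → n ((2 : ℝ) ^ (-j) • ξ) ≠ 0 → False)
    (f : 𝓢'(R3, C3)) : dyadicCutoff m k (dyadicCutoff n j f) = 0 := by
  rw [dyadicCutoff_dyadicCutoff hm hn, ← fourierMultiplierCLM_zero f]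
  congr 2
  ext ξ
  rw [Complex.ofReal_eq_zero]
  by_contra h0
  exact h ξ (right_ne_zero_of_mul h0) (left_ne_zero_of_mul h0)

/-- Only neighbouring dilates of a dyadic partition of unity contribute to an annular symbol. -/
theorem sum_dyadic_mul_eq {m n : R3 → ℝ} (hm : IsAnnularSymbol m (3 / 4) (8 / 3))
    (hn : IsAnnularSymbol n (3 / 4) (8 / 3))
    (hsum : ∀ ξ, ξ ≠ 0 → HasSum (fun j : ℤ => n ((2 : ℝ) ^ (-j) • ξ)) 1)
    {k : ℤ} {s : Finset ℤ} (hs : Finset.Icc (k - 1) (k + 1) ⊆ s) (ξ : R3) :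
    ∑ i ∈ s, n ((2 : ℝ) ^ (-i) • ξ) * m ((2 : ℝ) ^ (-k) • ξ) = m ((2 : ℝ) ^ (-k) • ξ) := by
  by_cases h : m ((2 : ℝ) ^ (-k) • ξ) = 0
  · simp only [h, mul_zero, Finset.sum_const_zero]
  have hξ : ξ ≠ 0 := by
    rintro rfl
    have := hm.lower _ h
    rw [smul_zero, norm_zero] at this
    norm_num at this
  have hfin : HasSum (fun j : ℤ => n ((2 : ℝ) ^ (-j) • ξ)) (∑ i ∈ s, n ((2 : ℝ) ^ (-i) • ξ)) := by
    refine hasSum_sum_of_ne_finset_zero fun i hi => ?_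
    by_contra hne
    have h1 := hm.index_lt hn (by norm_num) (c := 2) (by norm_num) h hne
    have h2 := hn.index_lt hm (by norm_num) (c := 2) (by norm_num) hne h
    exact hi (hs (Finset.mem_Icc.2 ⟨by omega, by omega⟩))
  rw [← Finset.sum_mul, hfin.unique (hsum ξ hξ), one_mul]

/-- A dyadic block is recovered from the neighbouring blocks of any other dyadic partition of
unity with the same support condition. -/
theorem dyadicCutoff_eq_sum {m n : R3 → ℝ} (hm : IsAnnularSymbol m (3 / 4) (8 / 3))
    (hn : IsAnnularSymbol n (3 / 4) (8 / 3))
    (hsum : ∀ ξ, ξ ≠ 0 → HasSum (fun j : ℤ => n ((2 : ℝ) ^ (-j) • ξ)) 1)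
    {k : ℤ} {s : Finset ℤ} (hs : Finset.Icc (k - 1) (k + 1) ⊆ s) (f : 𝓢'(R3, C3)) :
    dyadicCutoff m k f = ∑ i ∈ s, dyadicCutoff m k (dyadicCutoff n i f) := by
  have htg : ∀ i ∈ s, Function.HasTemperateGrowth fun ξ : R3 =>
      ((n ((2 : ℝ) ^ (-i) • ξ) * m ((2 : ℝ) ^ (-k) • ξ) : ℝ) : ℂ) := fun i _ => by
    have h := (hn.hasTemperateGrowth i).mul (hm.hasTemperateGrowth k)
    simp only [Complex.ofReal_mul]
    exact h
  simp_rw [dyadicCutoff_dyadicCutoff hm hn]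
  have h := congrArg (fun T => T f) (TemperedDistribution.fourierMultiplierCLM_sum C3 htg)
  simp only [sum_apply] at h
  rw [← h, dyadicCutoff]
  congr 2
  ext ξ
  rw [← Complex.ofReal_sum, sum_dyadic_mul_eq hm hn hsum hs]

/-! ### Real distributions -/

/-- Even real symbols have real kernels. -/
theorem conj_dyadicKernel {m : R3 → ℝ} (he : ∀ ξ, m (-ξ) = m ξ) (j : ℤ) (x : R3) :
    (starRingEnd ℂ) (dyadicKernel m j x) = dyadicKernel m j x := by
  rw [dyadicKernel, Real.fourierInv_eq, ← integral_conj]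
  rw [← integral_neg_eq_self]
  refine integral_congr_ae (Eventually.of_forall fun ξ => ?_)
  simp only [Circle.smul_def, smul_eq_mul, map_mul, Complex.conj_ofReal, inner_neg_left, smul_neg,
    he, AddChar.map_neg_eq_inv, Circle.coe_inv_eq_conj, Complex.conj_conj]

theorem IsReal.dyadicCutoff {m : R3 → ℝ} {r R : ℝ} (hm : IsAnnularSymbol m r R)
    (he : ∀ ξ, m (-ξ) = m ξ) (j : ℤ) {f : 𝓢'(R3, C3)} (hf : IsReal f) :
    IsReal (dyadicCutoff m j f) := by
  intro ψ hψ i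
  rw [dyadicCutoff_apply hm.smooth hm.hasCompactSupport]
  refine hf _ (fun y => ?_) i
  rw [dyadicCutoff_transpose_apply, ← Complex.conj_eq_iff_im, ← integral_conj]
  simp_rw [map_mul, conj_dyadicKernel he, Complex.conj_eq_iff_im.2 (hψ _)]

theorem IsReal.sub {f g : 𝓢'(R3, C3)} (hf : IsReal f) (hg : IsReal g) : IsReal (f - g) := by
  intro ψ hψ i
  have : (f - g) ψ = f ψ - g ψ := rfl
  simp [this, hf ψ hψ i, hg ψ hψ i]

theorem IsReal.of_hasSum {ι : Type*} {F : ι → 𝓢'(R3, C3)} {f : 𝓢'(R3, C3)}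
    (h : HasSum F f) (hF : ∀ j, IsReal (F j)) : IsReal f := by
  intro ψ hψ i
  have h1 := h.mapL (PointwiseConvergenceCLM.evalCLM (RingHom.id ℂ) C3 ψ)
  have h2 := (h1.mapL (EuclideanSpace.proj i : C3 →L[ℂ] ℂ)).mapL Complex.imCLM
  refine h2.unique (?_ : HasSum _ (0 : ℝ))
  convert! hasSum_zero with j
  exact hF j ψ hψ i

/-- A function representing a real distribution is real almost everywhere. -/
theorem IsReal.ae_im_eq_zero {f : 𝓢'(R3, C3)} (hf : IsReal f) {h : R3 → C3} {p : ℝ≥0∞}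
    (hp : 1 ≤ p) (hh : MemLp h p volume) (hr : Represents h f) :
    ∀ᵐ x, ∀ i, (h x i).im = 0 := by
  rw [ae_all_iff]
  intro i
  have hloc : LocallyIntegrable (fun x => (h x i).im) volume := by
    have h1 : LocallyIntegrable h volume := hh.locallyIntegrable hp
    intro x
    obtain ⟨U, hU, hUi⟩ := h1 x
    exact ⟨U, hU, (Complex.imCLM.comp
      ((EuclideanSpace.proj i : C3 →L[ℂ] ℂ).restrictScalars ℝ)).integrable_comp hUi⟩
  refine ae_eq_zero_of_integral_contDiff_smul_eq_zero hloc fun g hg hgc => ?_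
  have hg₁ : HasCompactSupport (Complex.ofRealCLM ∘ g) := hgc.comp_left rfl
  have hg₂ : ContDiff ℝ ∞ (Complex.ofRealCLM ∘ g) := by fun_prop
  set ψ : 𝓢(R3, ℂ) := hg₁.toSchwartzMap hg₂ with hψ
  have hψa : ∀ x, ψ x = (g x : ℂ) := fun x => rfl
  have h0 := hf ψ (fun x => by simp [hψa]) i
  rw [hr ψ] at h0
  have hint := integrable_smul_of_memLp hp hh ψ
  have h2 := (Complex.imCLM.comp
      ((EuclideanSpace.proj i : C3 →L[ℂ] ℂ).restrictScalars ℝ)).integral_comp_comm hint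
  calc _ = ∫ x, (Complex.imCLM.comp
      ((EuclideanSpace.proj i : C3 →L[ℂ] ℂ).restrictScalars ℝ)) (ψ x • h x) := by
        refine integral_congr_ae (Eventually.of_forall fun x => ?_)
        simp [hψa]
    _ = 0 := by rw [h2]; exact h0

theorem Represents.isReal {f : 𝓢'(R3, C3)} {h : R3 → C3} {p : ℝ≥0∞}
    (hp : 1 ≤ p) (hh : MemLp h p volume) (hr : Represents h f)
    (him : ∀ᵐ x, ∀ i, (h x i).im = 0) : IsReal f := by
  intro ψ hψ i
  rw [hr ψ]
  have hint := integrable_smul_of_memLp hp hh ψ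
  have h2 := (Complex.imCLM.comp
      ((EuclideanSpace.proj i : C3 →L[ℂ] ℂ).restrictScalars ℝ)).integral_comp_comm hint
  refine h2.symm.trans (integral_eq_zero_of_ae ?_)
  filter_upwards [him] with x hx
  simp [hx i, hψ x]

/-! ### Localized Leray projections -/

/-- The matrix unit `x ↦ x_b e_a`. -/
def matrixUnit (a b : Fin 3) : C3 →L[ℂ] C3 :=
  (EuclideanSpace.proj b : C3 →L[ℂ] ℂ).smulRight (EuclideanSpace.single a (1 : ℂ))

theorem matrixUnit_apply (a b : Fin 3) (x : C3) (i : Fin 3) :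
    matrixUnit a b x i = if i = a then x b else 0 := by
  simp [matrixUnit]

theorem norm_matrixUnit_le (a b : Fin 3) : ‖matrixUnit a b‖ ≤ 1 := by
  refine ContinuousLinearMap.opNorm_le_bound _ zero_le_one fun x => ?_
  have : matrixUnit a b x = x b • EuclideanSpace.single a (1 : ℂ) := rfl
  rw [this, norm_smul, PiLp.norm_single, norm_one, mul_one, one_mul]
  exact PiLp.norm_apply_le x b

/-- The entries of the symbol `θ(ξ) (1 - ξ ⊗ ξ / |ξ|²)` of the Leray projection localized by `θ`. -/
def leraySymbol (θ : R3 → ℝ) (a b : Fin 3) (ξ : R3) : ℝ :=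
  θ ξ * ((if a = b then 1 else 0) - ξ a * ξ b / ‖ξ‖ ^ 2)

/-- The dyadic block of the Leray projection: the multiplier with symbol
`θ(2^{-j} ξ) (1 - ξ ⊗ ξ / |ξ|²)`. -/
def lerayBlock (θ : R3 → ℝ) (j : ℤ) : 𝓢'(R3, C3) →L[ℂ] 𝓢'(R3, C3) :=
  ∑ a, ∑ b, mapValues (matrixUnit a b) ∘L TemperedDistribution.fourierMultiplierCLM C3
    (fun ξ : R3 => ((leraySymbol θ a b ((2 : ℝ) ^ (-j) • ξ) : ℝ) : ℂ))

theorem lerayBlock_eq (θ : R3 → ℝ) (j : ℤ) (f : 𝓢'(R3, C3)) :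
    lerayBlock θ j f =
      ∑ a, ∑ b, mapValues (matrixUnit a b) (dyadicCutoff (leraySymbol θ a b) j f) := by
  simp only [lerayBlock, sum_apply]
  rfl

theorem sum_tempered_apply {ι : Type*} (s : Finset ι) (F : ι → 𝓢'(R3, C3)) (ψ : 𝓢(R3, ℂ)) :
    (∑ i ∈ s, F i) ψ = ∑ i ∈ s, F i ψ :=
  map_sum (PointwiseConvergenceCLM.evalCLM (RingHom.id ℂ) C3 ψ) F s

theorem lerayBlock_apply_apply (θ : R3 → ℝ) (j : ℤ) (f : 𝓢'(R3, C3)) (ψ : 𝓢(R3, ℂ)) (i : Fin 3) :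
    lerayBlock θ j f ψ i = ∑ b, dyadicCutoff (leraySymbol θ i b) j f ψ b := by
  have hsum : ∀ (F : Fin 3 → C3), (∑ a, F a) i = ∑ a, F a i := fun F => by
    simp
  rw [lerayBlock_eq, sum_tempered_apply, hsum, Finset.sum_eq_single i]
  · rw [sum_tempered_apply, hsum]
    simp [matrixUnit_apply]
  · intro a _ ha
    rw [sum_tempered_apply, hsum]
    simp [matrixUnit_apply, ha.symm]
  · simp

theorem contDiffAt_coord (a : Fin 3) (ξ : R3) : ContDiffAt ℝ ∞ (fun ξ : R3 => ξ a) ξ :=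
  (EuclideanSpace.proj a : R3 →L[ℝ] ℝ).contDiff.contDiffAt

theorem isAnnularSymbol_leraySymbol {θ : R3 → ℝ} {r R : ℝ} (hθ : IsAnnularSymbol θ r R)
    (hr : 0 < r) (a b : Fin 3) : IsAnnularSymbol (leraySymbol θ a b) r R := by
  refine hθ.mul hr fun ξ hξ => contDiffAt_const.sub ?_
  exact ((contDiffAt_coord a ξ).mul (contDiffAt_coord b ξ)).div
    (contDiff_norm_sq ℝ).contDiffAt (by simpa using hξ)

theorem leraySymbol_neg {θ : R3 → ℝ} (he : ∀ ξ, θ (-ξ) = θ ξ) (a b : Fin 3) (ξ : R3) :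
    leraySymbol θ a b (-ξ) = leraySymbol θ a b ξ := by
  simp [leraySymbol, he]

theorem distLpNorm_lerayBlock_le_sum {p : ℝ≥0∞} [Fact (1 ≤ p)] (θ : R3 → ℝ) (j : ℤ)
    (f : 𝓢'(R3, C3)) : distLpNorm p (lerayBlock θ j f) ≤
      ∑ a, ∑ b, distLpNorm p (dyadicCutoff (leraySymbol θ a b) j f) := by
  rw [lerayBlock_eq]
  refine (distLpNorm_sum_le _ _).trans (Finset.sum_le_sum fun a _ => ?_)
  refine (distLpNorm_sum_le _ _).trans (Finset.sum_le_sum fun b _ => ?_)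
  exact distLpNorm_mapValues_le (norm_matrixUnit_le a b) _

theorem exists_distLpNorm_lerayBlock_le {θ : R3 → ℝ} {r R : ℝ} (hθ : IsAnnularSymbol θ r R)
    (hr : 0 < r) :
    ∃ A : ℝ≥0, ∀ (p : ℝ), 1 < p → ∀ (j : ℤ) (f : 𝓢'(R3, C3)),
      distLpNorm (ENNReal.ofReal p) (lerayBlock θ j f) ≤ A * distLpNorm (ENNReal.ofReal p) f := by
  have hs := isAnnularSymbol_leraySymbol hθ hr
  choose A hA using fun a b =>
    exists_distLpNorm_dyadicCutoff_le (hs a b).smooth (hs a b).hasCompactSupport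
  refine ⟨∑ a, ∑ b, A a b, fun p hp j f => ?_⟩
  have : Fact (1 ≤ ENNReal.ofReal p) := ⟨by simpa using hp.le⟩
  refine (distLpNorm_lerayBlock_le_sum θ j f).trans ?_
  push_cast
  simp_rw [Finset.sum_mul]
  exact Finset.sum_le_sum fun a _ => Finset.sum_le_sum fun b _ => hA a b p hp j f

theorem exists_distLpNorm_two_mul_lerayBlock_le {θ : R3 → ℝ} {r R : ℝ}
    (hθ : IsAnnularSymbol θ r R) (hr : 0 < r) {p : ℝ} (hp : 1 < p) :
    ∃ A : ℝ≥0, ∀ (j : ℤ) (f : 𝓢'(R3, C3)),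
      distLpNorm (ENNReal.ofReal (2 * p)) (lerayBlock θ j f) ≤
        A * ENNReal.ofReal ((2 : ℝ) ^ (3 * (j : ℝ) / (2 * p))) *
          distLpNorm (ENNReal.ofReal p) f := by
  have hs := isAnnularSymbol_leraySymbol hθ hr
  choose A hA using fun a b =>
    exists_distLpNorm_two_mul_dyadicCutoff_le (hs a b).smooth (hs a b).hasCompactSupport hp
  refine ⟨∑ a, ∑ b, A a b, fun j f => ?_⟩
  have : Fact (1 ≤ ENNReal.ofReal (2 * p)) := ⟨by
    rw [ENNReal.one_le_ofReal]; linarith⟩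
  refine (distLpNorm_lerayBlock_le_sum θ j f).trans ?_
  push_cast
  simp_rw [Finset.sum_mul]
  exact Finset.sum_le_sum fun a _ => Finset.sum_le_sum fun b _ => hA a b j f

theorem dyadicCutoff_mapValues (m : R3 → ℝ) (j : ℤ) (A : C3 →L[ℂ] C3) (f : 𝓢'(R3, C3)) :
    dyadicCutoff m j (mapValues A f) = mapValues A (dyadicCutoff m j f) := rfl

theorem dyadicCutoff_sum {ι : Type*} (m : R3 → ℝ) (j : ℤ) (s : Finset ι) (F : ι → 𝓢'(R3, C3)) :
    dyadicCutoff m j (∑ i ∈ s, F i) = ∑ i ∈ s, dyadicCutoff m j (F i) :=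
  map_sum (TemperedDistribution.fourierMultiplierCLM C3 _) F s

theorem dyadicCutoff_sub (m : R3 → ℝ) (j : ℤ) (f g : 𝓢'(R3, C3)) :
    dyadicCutoff m j (f - g) = dyadicCutoff m j f - dyadicCutoff m j g :=
  map_sub (TemperedDistribution.fourierMultiplierCLM C3 _) f g

theorem dyadicCutoff_lerayBlock_eq_zero {m θ : R3 → ℝ} {r R r' R' : ℝ}
    (hm : IsAnnularSymbol m r R) (hθ : IsAnnularSymbol θ r' R') (hr' : 0 < r') {k j : ℤ}
    (h : ∀ ξ, m ((2 : ℝ) ^ (-k) • ξ) ≠ 0 → θ ((2 : ℝ) ^ (-j) • ξ) ≠ 0 → False)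
    (f : 𝓢'(R3, C3)) : dyadicCutoff m k (lerayBlock θ j f) = 0 := by
  rw [lerayBlock_eq, dyadicCutoff_sum]
  refine Finset.sum_eq_zero fun a _ => ?_
  rw [dyadicCutoff_sum]
  refine Finset.sum_eq_zero fun b _ => ?_
  rw [dyadicCutoff_mapValues, dyadicCutoff_dyadicCutoff_eq_zero hm
    (isAnnularSymbol_leraySymbol hθ hr' a b)
    (fun ξ h1 h2 => h ξ h1 (left_ne_zero_of_mul h2)), map_zero]

theorem IsReal.lerayBlock {θ : R3 → ℝ} {r R : ℝ} (hθ : IsAnnularSymbol θ r R) (hr : 0 < r)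
    (he : ∀ ξ, θ (-ξ) = θ ξ) (j : ℤ) {f : 𝓢'(R3, C3)} (hf : IsReal f) :
    IsReal (lerayBlock θ j f) := by
  intro ψ hψ i
  rw [lerayBlock_apply_apply, Complex.im_sum]
  exact Finset.sum_eq_zero fun b _ =>
    hf.dyadicCutoff (isAnnularSymbol_leraySymbol hθ hr i b) (leraySymbol_neg he i b) j ψ hψ b

/-! ### Divergence-free distributions -/

theorem IsDivFree.sub {f g : 𝓢'(R3, C3)} (hf : IsDivFree f) (hg : IsDivFree g) :
    IsDivFree (f - g) := by
  intro ψ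
  have h := congrArg₂ (· - ·) (hf ψ) (hg ψ)
  simp only [← Finset.sum_sub_distrib, sub_zero] at h
  exact h

theorem IsDivFree.of_hasSum {ι : Type*} {F : ι → 𝓢'(R3, C3)} {f : 𝓢'(R3, C3)}
    (h : HasSum F f) (hF : ∀ j, IsDivFree (F j)) : IsDivFree f := by
  intro ψ
  have h1 : ∀ i : Fin 3, HasSum
      (fun j => (∂_{(EuclideanSpace.single i (1 : ℝ) : R3)} (F j)) ψ i)
      ((∂_{(EuclideanSpace.single i (1 : ℝ) : R3)} f) ψ i) := fun i =>
    (h.mapL (PointwiseConvergenceCLM.evalCLM (RingHom.id ℂ) C3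
      (-∂_{(EuclideanSpace.single i (1 : ℝ) : R3)} ψ))).mapL (EuclideanSpace.proj i : C3 →L[ℂ] ℂ)
  refine (hasSum_sum fun i (_ : i ∈ Finset.univ) => h1 i).unique ?_
  convert! hasSum_zero with j
  exact hF j ψ

/-- The partial derivative `∂_i` is the multiplier with symbol `2 π i ξ_i`. -/
theorem lineDeriv_single_eq (i : Fin 3) (f : 𝓢'(R3, C3)) :
    ∂_{(EuclideanSpace.single i (1 : ℝ) : R3)} f = (2 * Real.pi * Complex.I) •
      TemperedDistribution.fourierMultiplierCLM C3 (fun ξ : R3 => ((ξ i : ℝ) : ℂ)) f := by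
  rw [TemperedDistribution.lineDeriv_eq_fourierMultiplierCLM]
  congr 3
  ext ξ
  simp [EuclideanSpace.inner_single_right]

theorem hasTemperateGrowth_coord (i : Fin 3) :
    Function.HasTemperateGrowth fun ξ : R3 => ((ξ i : ℝ) : ℂ) :=
  (Complex.ofRealCLM.comp (EuclideanSpace.proj i : R3 →L[ℝ] ℝ)).hasTemperateGrowth

/-- The columns of the Leray symbol are orthogonal to `ξ`. -/
theorem sum_leraySymbol_mul_coord {θ : R3 → ℝ} {r R : ℝ} (hθ : IsAnnularSymbol θ r R) (hr : 0 < r)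
    (b : Fin 3) (j : ℤ) (ξ : R3) :
    ∑ a, leraySymbol θ a b ((2 : ℝ) ^ (-j) • ξ) * ξ a = 0 := by
  have key : ∀ η : R3, ∑ a, leraySymbol θ a b η * η a = 0 := by
    intro η
    by_cases hη : θ η = 0
    · simp [leraySymbol, hη]
    have hn : 0 < ‖η‖ := hr.trans_le (hθ.lower η hη)
    have hsq : ‖η‖ ^ 2 = ∑ a, η a * η a := by
      rw [EuclideanSpace.norm_sq_eq]; simp [sq]
    have e : ∀ a, leraySymbol θ a b η * η a =
        θ η * ((if a = b then η a else 0) - (η b / ‖η‖ ^ 2) * (η a * η a)) := by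
      intro a
      rw [leraySymbol]
      split_ifs <;> ring
    simp_rw [e]
    rw [← Finset.mul_sum, Finset.sum_sub_distrib, ← Finset.mul_sum, ← hsq,
      div_mul_cancel₀ _ (by positivity)]
    simp
  have h := key ((2 : ℝ) ^ (-j) • ξ)
  have e : ∀ a, ξ a = (2 : ℝ) ^ j * ((2 : ℝ) ^ (-j) • ξ) a := by
    intro a
    rw [PiLp.smul_apply, smul_eq_mul, ← mul_assoc, ← zpow_add₀ two_ne_zero]
    simp
  calc _ = ∑ a, (2 : ℝ) ^ j *
        (leraySymbol θ a b ((2 : ℝ) ^ (-j) • ξ) * ((2 : ℝ) ^ (-j) • ξ) a) := by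
        refine Finset.sum_congr rfl fun a _ => ?_
        linear_combination leraySymbol θ a b ((2 : ℝ) ^ (-j) • ξ) * e a
    _ = 0 := by rw [← Finset.mul_sum, h, mul_zero]

theorem isDivFree_lerayBlock {θ : R3 → ℝ} {r R : ℝ} (hθ : IsAnnularSymbol θ r R) (hr : 0 < r)
    (j : ℤ) (f : 𝓢'(R3, C3)) : IsDivFree (lerayBlock θ j f) := by
  intro ψ
  have hs := isAnnularSymbol_leraySymbol hθ hr
  have e1 : ∀ a : Fin 3, (∂_{(EuclideanSpace.single a (1 : ℝ) : R3)} (lerayBlock θ j f)) ψ a =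
      ∑ b, (∂_{(EuclideanSpace.single a (1 : ℝ) : R3)}
        (dyadicCutoff (leraySymbol θ a b) j f)) ψ b := fun a =>
    lerayBlock_apply_apply θ j f (-∂_{(EuclideanSpace.single a (1 : ℝ) : R3)} ψ) a
  simp_rw [e1]
  rw [Finset.sum_comm]
  refine Finset.sum_eq_zero fun b _ => ?_
  have e2 : ∑ a : Fin 3, ∂_{(EuclideanSpace.single a (1 : ℝ) : R3)}
      (dyadicCutoff (leraySymbol θ a b) j f) = 0 := by
    simp_rw [lineDeriv_single_eq, ← Finset.smul_sum, dyadicCutoff]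
    have htg : ∀ a ∈ (Finset.univ : Finset (Fin 3)), Function.HasTemperateGrowth
        ((fun ξ : R3 => ((leraySymbol θ a b ((2 : ℝ) ^ (-j) • ξ) : ℝ) : ℂ)) *
          fun ξ : R3 => ((ξ a : ℝ) : ℂ)) := fun a _ =>
      ((hs a b).hasTemperateGrowth j).mul (hasTemperateGrowth_coord a)
    have h := congrArg (fun T => T f) (TemperedDistribution.fourierMultiplierCLM_sum C3 htg)
    simp only [sum_apply] at h
    simp_rw [fun a => TemperedDistribution.fourierMultiplierCLM_fourierMultiplierCLM_apply
      ((hs a b).hasTemperateGrowth j) (hasTemperateGrowth_coord a) f]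
    rw [← h]
    have hz : (fun ξ : R3 => ∑ a : Fin 3,
        ((fun ξ : R3 => ((leraySymbol θ a b ((2 : ℝ) ^ (-j) • ξ) : ℝ) : ℂ)) *
          fun ξ : R3 => ((ξ a : ℝ) : ℂ)) ξ) = fun _ => 0 := by
      ext ξ
      have := sum_leraySymbol_mul_coord hθ hr b j ξ
      simp only [Pi.mul_apply, ← Complex.ofReal_mul, ← Complex.ofReal_sum, this, Complex.ofReal_zero]
    rw [hz, fourierMultiplierCLM_zero, smul_zero]
  have e3 := congrArg (fun F : 𝓢'(R3, C3) => F ψ b) e2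
  simp only [sum_tempered_apply] at e3
  simpa using e3

/-- Localized Leray projections reproduce the dyadic blocks of divergence-free distributions. -/
theorem IsDivFree.lerayBlock_dyadicCutoff {θ m : R3 → ℝ} {r R r' R' : ℝ}
    (hθ : IsAnnularSymbol θ r R) (hr : 0 < r) (hm : IsAnnularSymbol m r' R') (hr' : 0 < r')
    (hθm : ∀ ξ, m ξ * θ ξ = m ξ) (j : ℤ) {g : 𝓢'(R3, C3)} (hg : IsDivFree g) :
    lerayBlock θ j (dyadicCutoff m j g) = dyadicCutoff m j g := by
  have hs := isAnnularSymbol_leraySymbol hθ hr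
  ext ψ c
  rw [lerayBlock_apply_apply]
  -- the multiplier through which the divergence of `g` enters the gradient part
  set n : R3 → ℝ := fun ξ => m ξ * (ξ c / ‖ξ‖ ^ 2) with hn_def
  have hn : IsAnnularSymbol n r' R' := hm.mul hr' fun ξ hξ =>
    (contDiffAt_coord c ξ).div (contDiff_norm_sq ℝ).contDiffAt (by simpa using hξ)
  have e1 : ∀ b, dyadicCutoff (leraySymbol θ c b) j (dyadicCutoff m j g) =
      (if c = b then dyadicCutoff m j g else 0) -
        ((2 : ℂ) ^ (-j) * (2 * Real.pi * Complex.I)⁻¹) •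
          dyadicCutoff n j (∂_{(EuclideanSpace.single b (1 : ℝ) : R3)} g) := by
    intro b
    have h2pi : (2 * Real.pi * Complex.I : ℂ) ≠ 0 := Complex.two_pi_I_ne_zero
    have e2 : ((2 : ℂ) ^ (-j) * (2 * Real.pi * Complex.I)⁻¹) •
          dyadicCutoff n j (∂_{(EuclideanSpace.single b (1 : ℝ) : R3)} g) =
        TemperedDistribution.fourierMultiplierCLM C3 ((2 : ℂ) ^ (-j) •
          ((fun ξ : R3 => ((ξ b : ℝ) : ℂ)) *
            fun ξ : R3 => ((n ((2 : ℝ) ^ (-j) • ξ) : ℝ) : ℂ))) g := by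
      rw [TemperedDistribution.fourierMultiplierCLM_smul
          ((hasTemperateGrowth_coord b).mul (hn.hasTemperateGrowth j)),
        lineDeriv_single_eq, dyadicCutoff, map_smul,
        TemperedDistribution.fourierMultiplierCLM_fourierMultiplierCLM_apply
          (hasTemperateGrowth_coord b) (hn.hasTemperateGrowth j), smul_smul, mul_assoc,
        inv_mul_cancel₀ h2pi, mul_one]
      rfl
    have e3 : (if c = b then dyadicCutoff m j g else 0) =
        TemperedDistribution.fourierMultiplierCLM C3 ((if c = b then (1 : ℂ) else 0) •
          fun ξ : R3 => ((m ((2 : ℝ) ^ (-j) • ξ) : ℝ) : ℂ)) g := by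
      rw [TemperedDistribution.fourierMultiplierCLM_smul (hm.hasTemperateGrowth j)]
      split_ifs
      · rw [one_smul]; rfl
      · rw [zero_smul]; rfl
    rw [e2, e3, eq_sub_iff_add_eq, dyadicCutoff_dyadicCutoff (hs c b) hm]
    have htg1 : Function.HasTemperateGrowth fun ξ : R3 =>
        ((m ((2 : ℝ) ^ (-j) • ξ) * leraySymbol θ c b ((2 : ℝ) ^ (-j) • ξ) : ℝ) : ℂ) := by
      have h := (hm.hasTemperateGrowth j).mul ((hs c b).hasTemperateGrowth j)
      simp only [Complex.ofReal_mul]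
      exact h
    have htg2 : Function.HasTemperateGrowth ((2 : ℂ) ^ (-j) •
          ((fun ξ : R3 => ((ξ b : ℝ) : ℂ)) *
            fun ξ : R3 => ((n ((2 : ℝ) ^ (-j) • ξ) : ℝ) : ℂ))) :=
      (Function.HasTemperateGrowth.const ((2 : ℂ) ^ (-j))).mul
        ((hasTemperateGrowth_coord b).mul (hn.hasTemperateGrowth j))
    have hadd : ∀ {u v : R3 → ℂ}, Function.HasTemperateGrowth u → Function.HasTemperateGrowth v →
        TemperedDistribution.fourierMultiplierCLM C3 u g +
          TemperedDistribution.fourierMultiplierCLM C3 v g =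
        TemperedDistribution.fourierMultiplierCLM C3 (u + v) g := by
      intro u v hu hv
      rw [TemperedDistribution.fourierMultiplierCLM_apply,
        TemperedDistribution.fourierMultiplierCLM_apply,
        TemperedDistribution.fourierMultiplierCLM_apply,
        TemperedDistribution.smulLeftCLM_add hu hv, ← FourierTransform.fourierInv_add]
      rfl
    rw [hadd htg1 htg2]
    congr 2
    ext ξ
    simp only [Pi.add_apply, Pi.smul_apply, Pi.mul_apply, smul_eq_mul]
    set η : R3 := (2 : ℝ) ^ (-j) • ξ with hη
    have hηb : ((2 : ℂ) ^ (-j)) * (ξ b : ℂ) = ((η b : ℝ) : ℂ) := by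
      simp [hη]
    rw [← mul_assoc, hηb]
    have hreal : m η * leraySymbol θ c b η + η b * n η = (if c = b then 1 else 0) * m η := by
      have h1 : m η * leraySymbol θ c b η =
          m η * ((if c = b then 1 else 0) - η c * η b / ‖η‖ ^ 2) := by
        rw [leraySymbol, ← mul_assoc, hθm]
      rw [h1, hn_def]
      ring
    have := congrArg (fun t : ℝ => (t : ℂ)) hreal
    push_cast at this
    push_cast
    rw [this]
    split_ifs <;> simp
  have e4 : ∀ b, dyadicCutoff (leraySymbol θ c b) j (dyadicCutoff m j g) ψ b =
      (if c = b then dyadicCutoff m j g ψ b else 0) -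
        ((2 : ℂ) ^ (-j) * (2 * Real.pi * Complex.I)⁻¹) *
          dyadicCutoff n j (∂_{(EuclideanSpace.single b (1 : ℝ) : R3)} g) ψ b := by
    intro b
    rw [e1 b]
    split_ifs <;> rfl
  simp_rw [e4]
  rw [Finset.sum_sub_distrib, ← Finset.mul_sum]
  have hz : ∑ b : Fin 3,
      dyadicCutoff n j (∂_{(EuclideanSpace.single b (1 : ℝ) : R3)} g) ψ b = 0 :=
    hg (𝓕 (SchwartzMap.smulLeftCLM ℂ (dilatedSymbol hn.smooth hn.hasCompactSupport j) (𝓕⁻ ψ)))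
  rw [hz]
  simp

/-! ### Even symbols attached to a Littlewood–Paley pair -/

/-- The even part of a symbol. Multipliers with even real symbols preserve real distributions,
whereas the given function `φ` need not be even. -/
def evenPart (φ : R3 → ℝ) (ξ : R3) : ℝ := (φ ξ + φ (-ξ)) / 2

/-- The sum of the three neighbouring dyadic dilates of a symbol. -/
def fattened (a : R3 → ℝ) (ξ : R3) : ℝ := ∑ i ∈ Finset.Icc (-1 : ℤ) 1, a ((2 : ℝ) ^ (-i) • ξ)

theorem evenPart_neg (φ : R3 → ℝ) (ξ : R3) : evenPart φ (-ξ) = evenPart φ ξ := by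
  simp [evenPart, add_comm]

theorem fattened_evenPart_neg (φ : R3 → ℝ) (ξ : R3) :
    fattened (evenPart φ) (-ξ) = fattened (evenPart φ) ξ := by
  simp only [fattened, smul_neg, evenPart_neg]

namespace IsLittlewoodPaleyPair

variable {χ φ : R3 → ℝ}

theorem isAnnularSymbol_χ (h : IsLittlewoodPaleyPair χ φ) : IsAnnularSymbol χ 0 (4 / 3) where
  smooth := h.smooth_χ
  lower ξ _ := norm_nonneg ξ
  upper _ hξ := h.supp_χ (subset_tsupport _ hξ)

theorem isAnnularSymbol_φ (h : IsLittlewoodPaleyPair χ φ) :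
    IsAnnularSymbol φ (3 / 4) (8 / 3) where
  smooth := h.smooth_φ
  lower _ hξ := (h.supp_φ (subset_tsupport _ hξ)).1
  upper _ hξ := (h.supp_φ (subset_tsupport _ hξ)).2

theorem isAnnularSymbol_evenPart (h : IsLittlewoodPaleyPair χ φ) :
    IsAnnularSymbol (evenPart φ) (3 / 4) (8 / 3) := by
  have hφ := h.isAnnularSymbol_φ
  have key : ∀ ξ, evenPart φ ξ ≠ 0 → φ ξ ≠ 0 ∨ φ (-ξ) ≠ 0 := by
    intro ξ hξ
    by_contra! hc
    exact hξ (by simp [evenPart, hc.1, hc.2])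
  refine ⟨(hφ.smooth.add (hφ.smooth.comp contDiff_neg)).div_const 2, fun ξ hξ => ?_,
    fun ξ hξ => ?_⟩
  · rcases key ξ hξ with h1 | h1
    · exact hφ.lower ξ h1
    · simpa using hφ.lower _ h1
  · rcases key ξ hξ with h1 | h1
    · exact hφ.upper ξ h1
    · simpa using hφ.upper _ h1

theorem hasSum_evenPart (h : IsLittlewoodPaleyPair χ φ) (ξ : R3) (hξ : ξ ≠ 0) :
    HasSum (fun j : ℤ => evenPart φ ((2 : ℝ) ^ (-j) • ξ)) 1 := by
  have h1 := ((h.sum_int ξ hξ).add (h.sum_int (-ξ) (neg_ne_zero.2 hξ))).div_const 2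
  simp only [smul_neg] at h1
  convert! h1 using 1
  norm_num

theorem isAnnularSymbol_fattened (h : IsLittlewoodPaleyPair χ φ) :
    IsAnnularSymbol (fattened (evenPart φ)) (3 / 8) (16 / 3) := by
  have ha := h.isAnnularSymbol_evenPart
  have key : ∀ ξ, fattened (evenPart φ) ξ ≠ 0 →
      ∃ i ∈ Finset.Icc (-1 : ℤ) 1, evenPart φ ((2 : ℝ) ^ (-i) • ξ) ≠ 0 := fun ξ hξ =>
    Finset.exists_ne_zero_of_sum_ne_zero hξ
  refine ⟨ContDiff.sum fun i _ => ha.smooth.comp (contDiff_const_smul _), fun ξ hξ => ?_,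
    fun ξ hξ => ?_⟩
  · obtain ⟨i, hi, hne⟩ := key ξ hξ
    have h1 := ha.le_norm_of_comp_ne_zero hne
    have h2 : (2 : ℝ) ^ (-1 : ℤ) ≤ 2 ^ i := zpow_le_zpow_right₀ one_le_two (Finset.mem_Icc.1 hi).1
    norm_num at h2
    linarith
  · obtain ⟨i, hi, hne⟩ := key ξ hξ
    have h1 := ha.norm_le_of_comp_ne_zero hne
    have h2 : (2 : ℝ) ^ i ≤ 2 ^ (1 : ℤ) := zpow_le_zpow_right₀ one_le_two (Finset.mem_Icc.1 hi).2
    norm_num at h2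
    linarith

theorem evenPart_mul_fattened (h : IsLittlewoodPaleyPair χ φ) (ξ : R3) :
    evenPart φ ξ * fattened (evenPart φ) ξ = evenPart φ ξ := by
  have h1 := sum_dyadic_mul_eq h.isAnnularSymbol_evenPart h.isAnnularSymbol_evenPart
    h.hasSum_evenPart (k := 0) (s := Finset.Icc (-1 : ℤ) 1) (by simp) ξ
  rw [← Finset.sum_mul, neg_zero, zpow_zero, one_smul] at h1
  rw [mul_comm]
  exact h1

end IsLittlewoodPaleyPair

/-! ### Truncation at a given height -/

section Truncation

/-- The part of `h` where it is larger than `t`. -/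
def tallPart (t : ℝ) (h : R3 → C3) : R3 → C3 := {x | t < ‖h x‖}.indicator h

/-- The part of `h` where it is at most `t`. -/
def shortPart (t : ℝ) (h : R3 → C3) : R3 → C3 := {x | t < ‖h x‖}ᶜ.indicator h

theorem tallPart_add_shortPart (t : ℝ) (h : R3 → C3) (x : R3) :
    tallPart t h x + shortPart t h x = h x :=
  congrFun (Set.indicator_self_add_compl {x | t < ‖h x‖} h) x

variable {h : R3 → C3} {t : ℝ}

theorem nullMeasurableSet_lt_norm (hh : AEStronglyMeasurable h volume) :
    NullMeasurableSet {x | t < ‖h x‖} (volume : Measure R3) :=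
  nullMeasurableSet_lt aemeasurable_const hh.norm.aemeasurable

theorem aestronglyMeasurable_tallPart (hh : AEStronglyMeasurable h volume) :
    AEStronglyMeasurable (tallPart t h) volume := hh.indicator₀ (nullMeasurableSet_lt_norm hh)

theorem aestronglyMeasurable_shortPart (hh : AEStronglyMeasurable h volume) :
    AEStronglyMeasurable (shortPart t h) volume :=
  hh.indicator₀ (nullMeasurableSet_lt_norm hh).compl

theorem eLpNorm_tallPart_le (p : ℝ≥0∞) :
    eLpNorm (tallPart t h) p volume ≤ eLpNorm h p volume := eLpNorm_indicator_le h

theorem eLpNorm_shortPart_le (p : ℝ≥0∞) :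
    eLpNorm (shortPart t h) p volume ≤ eLpNorm h p volume := eLpNorm_indicator_le h

theorem lintegral_rpow_le_of_eLpNorm_le {p B : ℝ} (hp : 0 < p) (hB : 0 ≤ B)
    (hH : eLpNorm h (ENNReal.ofReal p) volume ≤ ENNReal.ofReal B) :
    ∫⁻ x, ‖h x‖ₑ ^ p ≤ ENNReal.ofReal (B ^ p) := by
  rw [eLpNorm_ofReal hp] at hH
  have := ENNReal.rpow_le_rpow hH hp.le
  rwa [← ENNReal.rpow_mul, one_div_mul_cancel hp.ne', ENNReal.rpow_one,
    ENNReal.ofReal_rpow_of_nonneg hB hp.le] at this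

/-- The tall part of an `L_p` function, `p ≥ 2`, lies in `L_2`. -/
theorem eLpNorm_two_tallPart_le {p B : ℝ} (hp : 2 ≤ p) (hB : 0 ≤ B) (ht : 0 < t)
    (hH : eLpNorm h (ENNReal.ofReal p) volume ≤ ENNReal.ofReal B) :
    eLpNorm (tallPart t h) 2 volume ≤ ENNReal.ofReal ((t ^ (2 - p) * B ^ p) ^ (1 / 2 : ℝ)) := by
  have h2 := eLpNorm_ofReal two_pos (tallPart t h)
  rw [ENNReal.ofReal_ofNat] at h2
  rw [h2, ← ENNReal.ofReal_rpow_of_nonneg (by positivity) (by norm_num),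
    ENNReal.ofReal_mul (by positivity)]
  refine ENNReal.rpow_le_rpow ?_ (by norm_num)
  calc ∫⁻ x, ‖tallPart t h x‖ₑ ^ (2 : ℝ)
      ≤ ∫⁻ x, ENNReal.ofReal (t ^ (2 - p)) * ‖h x‖ₑ ^ p := by
        refine lintegral_mono fun x => ?_
        by_cases hx : t < ‖h x‖
        · have e : tallPart t h x = h x := Set.indicator_of_mem (s := {x | t < ‖h x‖}) hx h
          rw [e, ← ofReal_norm, ENNReal.ofReal_rpow_of_nonneg (norm_nonneg _) two_pos.le,
            ENNReal.ofReal_rpow_of_nonneg (norm_nonneg _) (by linarith),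
            ← ENNReal.ofReal_mul (by positivity)]
          refine ENNReal.ofReal_le_ofReal ?_
          have hpos : 0 < ‖h x‖ := ht.trans hx
          have h3 : ‖h x‖ ^ (2 - p) ≤ t ^ (2 - p) :=
            Real.rpow_le_rpow_of_nonpos ht hx.le (by linarith)
          calc ‖h x‖ ^ (2 : ℝ) = ‖h x‖ ^ (2 - p) * ‖h x‖ ^ p := by
                rw [← Real.rpow_add hpos]; congr 1; ring
            _ ≤ _ := by gcongr
        · have e : tallPart t h x = 0 := Set.indicator_of_notMem (s := {x | t < ‖h x‖}) hx h
          simp [e]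
    _ = ENNReal.ofReal (t ^ (2 - p)) * ∫⁻ x, ‖h x‖ₑ ^ p :=
        lintegral_const_mul' _ _ ENNReal.ofReal_ne_top
    _ ≤ _ := by
        gcongr
        exact lintegral_rpow_le_of_eLpNorm_le (by linarith) hB hH

/-- The short part of an `L_p` function lies in `L_{2p}`. -/
theorem eLpNorm_two_mul_shortPart_le {p B : ℝ} (hp : 0 < p) (hB : 0 ≤ B) (ht : 0 < t)
    (hH : eLpNorm h (ENNReal.ofReal p) volume ≤ ENNReal.ofReal B) :
    eLpNorm (shortPart t h) (ENNReal.ofReal (2 * p)) volume ≤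
      ENNReal.ofReal ((t * B) ^ (1 / 2 : ℝ)) := by
  have e0 : ENNReal.ofReal ((t * B) ^ (1 / 2 : ℝ)) =
      (ENNReal.ofReal (t ^ p) * ENNReal.ofReal (B ^ p)) ^ (1 / (2 * p)) := by
    rw [← ENNReal.ofReal_mul (by positivity), ← Real.mul_rpow ht.le hB,
      ENNReal.ofReal_rpow_of_nonneg (by positivity) (by positivity),
      ← Real.rpow_mul (by positivity)]
    congr 2
    field_simp
  rw [e0, eLpNorm_ofReal (by positivity)]
  refine ENNReal.rpow_le_rpow ?_ (by positivity)
  calc ∫⁻ x, ‖shortPart t h x‖ₑ ^ (2 * p)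
      ≤ ∫⁻ x, ENNReal.ofReal (t ^ p) * ‖h x‖ₑ ^ p := by
        refine lintegral_mono fun x => ?_
        by_cases hx : t < ‖h x‖
        · have e : shortPart t h x = 0 :=
            Set.indicator_of_notMem (s := {x | t < ‖h x‖}ᶜ) (by simpa using hx) h
          simp [e, hp]
        · have e : shortPart t h x = h x :=
            Set.indicator_of_mem (s := {x | t < ‖h x‖}ᶜ) (by simpa using hx) h
          rw [e, two_mul, ENNReal.rpow_add_of_nonneg _ _ hp.le hp.le]
          gcongr
          rw [← ENNReal.ofReal_rpow_of_nonneg ht.le hp.le, ← ofReal_norm]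
          exact ENNReal.rpow_le_rpow (ENNReal.ofReal_le_ofReal (not_lt.1 hx)) hp.le
    _ = ENNReal.ofReal (t ^ p) * ∫⁻ x, ‖h x‖ₑ ^ p :=
        lintegral_const_mul' _ _ ENNReal.ofReal_ne_top
    _ ≤ _ := by
        gcongr
        exact lintegral_rpow_le_of_eLpNorm_le hp hB hH

/-- Truncation of a distribution in `L_p` at height `t`: a part in `L_p ∩ L_2` and a part in
`L_p ∩ L_{2p}`; the former is real if the distribution is. -/
theorem exists_truncation {p B : ℝ} (hp : 2 ≤ p) (hB : 0 ≤ B) (ht : 0 < t) {f : 𝓢'(R3, C3)}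
    (hf : distLpNorm (ENNReal.ofReal p) f < ENNReal.ofReal B) :
    ∃ b s : 𝓢'(R3, C3), f = b + s ∧ (IsReal f → IsReal b) ∧
      distLpNorm (ENNReal.ofReal p) b ≤ ENNReal.ofReal B ∧
      distLpNorm (ENNReal.ofReal p) s ≤ ENNReal.ofReal B ∧
      distLpNorm 2 b ≤ ENNReal.ofReal ((t ^ (2 - p) * B ^ p) ^ (1 / 2 : ℝ)) ∧
      distLpNorm (ENNReal.ofReal (2 * p)) s ≤ ENNReal.ofReal ((t * B) ^ (1 / 2 : ℝ)) := by
  obtain ⟨h, hh, hr, hlt⟩ := exists_represents_of_distLpNorm_lt hf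
  have hp1 : 1 ≤ ENNReal.ofReal p := by rw [ENNReal.one_le_ofReal]; linarith
  have : Fact (1 ≤ ENNReal.ofReal p) := ⟨hp1⟩
  have hb : MemLp (tallPart t h) (ENNReal.ofReal p) volume :=
    ⟨aestronglyMeasurable_tallPart hh.1, (eLpNorm_tallPart_le _).trans_lt hh.2⟩
  have hs : MemLp (shortPart t h) (ENNReal.ofReal p) volume :=
    ⟨aestronglyMeasurable_shortPart hh.1, (eLpNorm_shortPart_le _).trans_lt hh.2⟩
  have hrep : ∀ {u : R3 → C3} (hu : MemLp u (ENNReal.ofReal p) volume),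
      Represents u ((hu.toLp u : Lp C3 (ENNReal.ofReal p) volume) : 𝓢'(R3, C3)) := by
    intro u hu ψ
    rw [Lp.toTemperedDistribution_apply]
    refine integral_congr_ae ?_
    filter_upwards [hu.coeFn_toLp] with x hx
    rw [hx]
  have hb2 := eLpNorm_two_tallPart_le hp hB ht hlt.le
  have hs2 := eLpNorm_two_mul_shortPart_le (by linarith : 0 < p) hB ht hlt.le
  refine ⟨_, _, ?_, fun hreal => ?_, ((hrep hb).distLpNorm_le hb).trans ?_,
    ((hrep hs).distLpNorm_le hs).trans ?_, ((hrep hb).distLpNorm_le ?_).trans hb2,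
    ((hrep hs).distLpNorm_le ?_).trans hs2⟩
  · ext1 ψ
    have hadd : ∀ u v : 𝓢'(R3, C3), (u + v) ψ = u ψ + v ψ := fun _ _ => rfl
    rw [hadd, hr ψ, hrep hb ψ, hrep hs ψ, ← integral_add (integrable_smul_of_memLp hp1 hb ψ)
      (integrable_smul_of_memLp hp1 hs ψ)]
    simp_rw [← smul_add, tallPart_add_shortPart]
  · refine (hrep hb).isReal hp1 hb ?_
    filter_upwards [hreal.ae_im_eq_zero hp1 hh hr] with x hx i
    rw [tallPart, Set.indicator_apply]
    split_ifs
    · exact hx i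
    · simp
  · exact (eLpNorm_tallPart_le _).trans hlt.le
  · exact (eLpNorm_shortPart_le _).trans hlt.le
  · exact ⟨aestronglyMeasurable_tallPart hh.1, hb2.trans_lt ENNReal.ofReal_lt_top⟩
  · exact ⟨aestronglyMeasurable_shortPart hh.1, hs2.trans_lt ENNReal.ofReal_lt_top⟩

end Truncation

/-! ### Dyadic weights -/

theorem summable_two_rpow_neg_abs {c : ℝ} (hc : 0 < c) :
    Summable fun j : ℤ => (2 : ℝ) ^ (-(c * |(j : ℝ)|)) := by
  have hr : (2 : ℝ) ^ (-c) < 1 := Real.rpow_lt_one_of_one_lt_of_neg one_lt_two (by linarith)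
  have hg : Summable fun n : ℕ => ((2 : ℝ) ^ (-c)) ^ n :=
    summable_geometric_of_lt_one (by positivity) hr
  have e : ∀ n : ℕ, ((2 : ℝ) ^ (-c)) ^ n = (2 : ℝ) ^ (-(c * (n : ℝ))) := by
    intro n
    rw [← Real.rpow_natCast, ← Real.rpow_mul zero_le_two]
    congr 1; ring
  simp_rw [e] at hg
  refine Summable.of_nat_of_neg ?_ ?_ <;> simpa using hg

theorem summable_two_rpow_neg_abs_sub {c : ℝ} (hc : 0 < c) (J : ℤ) :
    Summable fun j : ℤ => (2 : ℝ) ^ (-(c * |(j : ℝ) - J|)) := by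
  have := (Equiv.subRight J).summable_iff.2 (summable_two_rpow_neg_abs hc)
  simpa [Function.comp_def] using this

theorem tsum_two_rpow_neg_abs_sub (c : ℝ) (J : ℤ) :
    ∑' j : ℤ, (2 : ℝ) ^ (-(c * |(j : ℝ) - J|)) = ∑' j : ℤ, (2 : ℝ) ^ (-(c * |(j : ℝ)|)) := by
  have := (Equiv.subRight J).tsum_eq fun j : ℤ => (2 : ℝ) ^ (-(c * |(j : ℝ)|))
  simpa using this

/-- A sum over a window of five neighbouring dyadic indices of terms with slowly varying weights
is controlled by the central weight. The constant is `40 = 5 * 2 ^ 3`. -/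
theorem sum_window_le {x : ℤ → ℝ≥0∞} {w : ℤ → ℝ} {c : ℝ} (hc : 0 ≤ c) {k : ℤ}
    (hx : ∀ i ∈ Finset.Icc (k - 2) (k + 2), x i ≤ ENNReal.ofReal (c * (2 : ℝ) ^ w i))
    (hw : ∀ i ∈ Finset.Icc (k - 2) (k + 2), w i ≤ w k + 3) :
    ∑ i ∈ Finset.Icc (k - 2) (k + 2), x i ≤ ENNReal.ofReal (40 * c * (2 : ℝ) ^ w k) := by
  have hterm : ∀ i ∈ Finset.Icc (k - 2) (k + 2), x i ≤ ENNReal.ofReal (8 * c * (2 : ℝ) ^ w k) := by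
    intro i hi
    refine (hx i hi).trans (ENNReal.ofReal_le_ofReal ?_)
    have h1 : (2 : ℝ) ^ w i ≤ 2 ^ (w k + 3) := Real.rpow_le_rpow_of_exponent_le one_le_two (hw i hi)
    rw [Real.rpow_add zero_lt_two] at h1
    have h2 : (2 : ℝ) ^ (3 : ℝ) = 8 := by norm_num
    rw [h2] at h1
    calc _ ≤ c * (2 ^ w k * 8) := by gcongr
      _ = _ := by ring
  refine (Finset.sum_le_card_nsmul _ _ _ hterm).trans_eq ?_
  have hcard : (Finset.Icc (k - 2) (k + 2)).card = 5 := by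
    rw [Int.card_Icc]; omega
  rw [hcard, nsmul_eq_mul, show ((5 : ℕ) : ℝ≥0∞) = ENNReal.ofReal 5 by simp,
    ← ENNReal.ofReal_mul (by norm_num)]
  congr 1; ring

/-- The gain of regularity `δ = 1 / (4 (p - 2))` of the regular part. With this choice
`(p - 3) / (p - 2) = 1 - 4 δ`, so truncation heights growing like `2 ^ (j (1 - 3 δ))` grow fast
enough for the `L_2` norms of the tall parts to decay, and more slowly than `2 ^ (j (1 - 2 δ))`,
as the short parts require. -/
def regularityGain (p : ℝ) : ℝ := 1 / (4 * (p - 2))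

/-- The binary logarithm of the bound, relative to the norm of `g`, for the `L_{2p}` norm of the
`j`-th block of the regular part when the splitting frequency is `2 ^ J`: the Besov weight is
compensated, up to the factor `2 ^ (J δ)` and geometric decay in `|j - J|`. -/
def regularWeight (p : ℝ) (J j : ℤ) : ℝ :=
  -((j : ℝ) * (critIndex (2 * p) + regularityGain p)) + J * regularityGain p -
    regularityGain p / 2 * |(j : ℝ) - J|

theorem regularityGain_pos {p : ℝ} (hp : 3 < p) : 0 < regularityGain p := by
  have : 0 < p - 2 := by linarith
  unfold regularityGain; positivity

theorem regularityGain_lt {p : ℝ} (hp : 3 < p) : regularityGain p < 1 / 4 := by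
  unfold regularityGain
  rw [div_lt_div_iff₀ (by linarith) (by norm_num)]
  linarith

theorem three_div_lt_one {p : ℝ} (hp : 3 < p) : 3 / p < 1 := by
  rw [div_lt_one (by linarith)]; exact hp

theorem critIndex_two_mul (p : ℝ) : critIndex (2 * p) = -1 + 3 / p / 2 := by
  rw [critIndex, div_div, mul_comm 2 p]

theorem regularWeight_le {p : ℝ} (hp : 3 < p) (J : ℤ) {k i : ℤ}
    (hi : i ∈ Finset.Icc (k - 2) (k + 2)) :
    regularWeight p J i ≤ regularWeight p J k + 3 := by
  obtain ⟨h1, h2⟩ := Finset.mem_Icc.1 hi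
  have h1' : (k : ℝ) - 2 ≤ i := by exact_mod_cast h1
  have h2' : (i : ℝ) ≤ k + 2 := by exact_mod_cast h2
  have h3 := regularityGain_pos hp
  have h4 := regularityGain_lt hp
  have h5 := three_div_lt_one hp
  have h6 : 0 < 3 / p := by positivity
  have habs : |(k : ℝ) - J| ≤ |(i : ℝ) - J| + 2 := by
    have : |(k : ℝ) - i| ≤ 2 := abs_le.2 ⟨by linarith, by linarith⟩
    calc |(k : ℝ) - J| = |((i : ℝ) - J) + (k - i)| := by ring_nf
      _ ≤ |(i : ℝ) - J| + |(k : ℝ) - i| := abs_add_le _ _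
      _ ≤ _ := by linarith
  unfold regularWeight
  rw [critIndex_two_mul]
  set δ := regularityGain p
  set t := 3 / p
  have h7 : δ / 2 * |(k : ℝ) - J| ≤ δ / 2 * (|(i : ℝ) - J| + 2) := by gcongr
  have h8 : ((k : ℝ) - i) * (-1 + t / 2 + δ) ≤ 2 := by
    have : |((k : ℝ) - i) * (-1 + t / 2 + δ)| ≤ 2 * 1 := by
      rw [abs_mul]
      gcongr
      · exact abs_le.2 ⟨by linarith, by linarith⟩
      · exact abs_le.2 ⟨by linarith, by linarith⟩
    linarith [le_abs_self (((k : ℝ) - i) * (-1 + t / 2 + δ))]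
  nlinarith

theorem critWeight_le {p : ℝ} (hp : 3 < p) {k i : ℤ} (hi : i ∈ Finset.Icc (k - 2) (k + 2)) :
    (i : ℝ) * (1 - 3 / p) ≤ k * (1 - 3 / p) + 3 := by
  obtain ⟨-, h2⟩ := Finset.mem_Icc.1 hi
  have h2' : (i : ℝ) ≤ k + 2 := by exact_mod_cast h2
  have h5 := three_div_lt_one hp
  have h6 : 0 < 3 / p := by positivity
  nlinarith

/-! ### Splitting one dyadic block -/

/-- The truncation of a single block. Blocks below the splitting frequency `2 ^ J` are not
truncated; above it, the truncation height is `M 2 ^ (J + (j - J) (1 - 3 δ))`, which makes the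
`L_2` norms of the tall parts and the weighted `L_{2p}` norms of the short parts decay
geometrically away from `j = J`. -/
theorem exists_block_splitting {p : ℝ} (hp : 3 < p) {M : ℝ} (hM : 0 < M) (J j : ℤ)
    {f : 𝓢'(R3, C3)}
    (hf : distLpNorm (ENNReal.ofReal p) f < ENNReal.ofReal (M * (2 : ℝ) ^ (j * (1 - 3 / p)))) :
    ∃ b s : 𝓢'(R3, C3), f = b + s ∧ (IsReal f → IsReal b) ∧ (j < J → b = 0) ∧
      distLpNorm (ENNReal.ofReal p) b ≤ ENNReal.ofReal (M * (2 : ℝ) ^ (j * (1 - 3 / p))) ∧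
      distLpNorm (ENNReal.ofReal p) s ≤ ENNReal.ofReal (M * (2 : ℝ) ^ (j * (1 - 3 / p))) ∧
      distLpNorm 2 b ≤
        ENNReal.ofReal (M * (2 : ℝ) ^ (-(J / 2 : ℝ) - 1 / 8 * |(j : ℝ) - J|)) ∧
      (J ≤ j → distLpNorm (ENNReal.ofReal (2 * p)) s ≤
        ENNReal.ofReal (M * (2 : ℝ) ^ regularWeight p J j)) := by
  rcases lt_or_ge j J with hj | hj
  · refine ⟨0, f, (zero_add f).symm, fun _ ψ _ i => by simp, fun _ => rfl, ?_, hf.le, ?_,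
      fun h => absurd h (not_le.2 hj)⟩ <;> simp [distLpNorm_zero]
  have hjR : (0 : ℝ) ≤ (j : ℝ) - J := by
    have : (J : ℝ) ≤ j := by exact_mod_cast hj
    linarith
  set δ := regularityGain p with hδ
  have hδp : δ * (4 * (p - 2)) = 1 := by
    have : p - 2 ≠ 0 := by linarith
    rw [hδ, regularityGain]; field_simp
  set u : ℝ := J + (j - J) * (1 - 3 * δ) with hu
  set v : ℝ := j * (1 - 3 / p) with hv
  have hvp : v * p = j * (p - 3) := by
    have : p ≠ 0 := by linarith
    rw [hv]; field_simp
  obtain ⟨b, s, hfs, hreal, h1, h2, h3, h4⟩ := exists_truncation (p := p) (by linarith)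
    (B := M * (2 : ℝ) ^ v) (t := M * (2 : ℝ) ^ u) (by positivity) (by positivity) hf
  refine ⟨b, s, hfs, hreal, fun h => absurd hj (not_le.2 h), h1, h2, h3.trans_eq ?_,
    fun _ => h4.trans_eq ?_⟩
  · congr 1
    rw [Real.mul_rpow hM.le (by positivity), Real.mul_rpow hM.le (by positivity),
      mul_mul_mul_comm, ← Real.rpow_add hM, ← Real.rpow_mul zero_le_two,
      ← Real.rpow_mul zero_le_two, ← Real.rpow_add zero_lt_two,
      Real.mul_rpow (by positivity) (by positivity), ← Real.rpow_mul hM.le,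
      ← Real.rpow_mul zero_le_two, hvp, abs_of_nonneg hjR]
    congr 2
    · rw [show (2 - p + p) * (1 / 2) = 1 by ring, Real.rpow_one]
    · rw [hu]
      linear_combination (((j : ℝ) - J) * 3 / 8) * hδp
  · congr 1
    rw [mul_mul_mul_comm, ← Real.rpow_add zero_lt_two, ← sq, ← Real.rpow_natCast M 2,
      Real.mul_rpow (by positivity) (by positivity), ← Real.rpow_mul hM.le,
      ← Real.rpow_mul zero_le_two]
    congr 2
    · norm_num
    · rw [regularWeight, critIndex_two_mul, abs_of_nonneg hjR, hu, hv]
      ring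

/-! ### The decomposition -/

/-- One constant `K` bounds all the multipliers of the decomposition on `L_p` for every
`1 < p < ∞`, and in Bernstein's inequality. -/
theorem exists_uniform_multiplier_bound {χ φ : R3 → ℝ} (h : IsLittlewoodPaleyPair χ φ) {p : ℝ}
    (hp : 1 < p) :
    ∃ K : ℝ, 0 < K ∧
      (∀ r : ℝ, 1 < r → ∀ (j : ℤ) (f : 𝓢'(R3, C3)),
        distLpNorm (ENNReal.ofReal r) (dyadicCutoff φ j f) ≤
          ENNReal.ofReal K * distLpNorm (ENNReal.ofReal r) f) ∧
      (∀ r : ℝ, 1 < r → ∀ (j : ℤ) (f : 𝓢'(R3, C3)),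
        distLpNorm (ENNReal.ofReal r) (dyadicCutoff (evenPart φ) j f) ≤
          ENNReal.ofReal K * distLpNorm (ENNReal.ofReal r) f) ∧
      (∀ r : ℝ, 1 < r → ∀ (j : ℤ) (f : 𝓢'(R3, C3)),
        distLpNorm (ENNReal.ofReal r) (lerayBlock (fattened (evenPart φ)) j f) ≤
          ENNReal.ofReal K * distLpNorm (ENNReal.ofReal r) f) ∧
      (∀ (j : ℤ) (f : 𝓢'(R3, C3)),
        distLpNorm (ENNReal.ofReal (2 * p)) (lerayBlock (fattened (evenPart φ)) j f) ≤
          ENNReal.ofReal K * ENNReal.ofReal ((2 : ℝ) ^ (3 * (j : ℝ) / (2 * p))) *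
            distLpNorm (ENNReal.ofReal p) f) := by
  have hφ := h.isAnnularSymbol_φ
  have ha := h.isAnnularSymbol_evenPart
  obtain ⟨A₁, h₁⟩ := exists_distLpNorm_dyadicCutoff_le hφ.smooth hφ.hasCompactSupport
  obtain ⟨A₂, h₂⟩ := exists_distLpNorm_dyadicCutoff_le ha.smooth ha.hasCompactSupport
  obtain ⟨A₃, h₃⟩ := exists_distLpNorm_lerayBlock_le h.isAnnularSymbol_fattened (by norm_num)
  obtain ⟨A₄, h₄⟩ :=
    exists_distLpNorm_two_mul_lerayBlock_le h.isAnnularSymbol_fattened (by norm_num) hp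
  have hle : ∀ A : ℝ≥0, A ≤ A₁ + A₂ + A₃ + A₄ + 1 →
      (A : ℝ≥0∞) ≤ ENNReal.ofReal ((A₁ + A₂ + A₃ + A₄ + 1 : ℝ≥0) : ℝ) := fun A hA => by
    rw [ENNReal.ofReal_coe_nnreal]; exact_mod_cast hA
  refine ⟨(A₁ + A₂ + A₃ + A₄ + 1 : ℝ≥0), by positivity, fun r hr j f => (h₁ r hr j f).trans ?_,
    fun r hr j f => (h₂ r hr j f).trans ?_, fun r hr j f => (h₃ r hr j f).trans ?_,
    fun j f => (h₄ j f).trans ?_⟩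
  · gcongr
    refine hle _ ?_
    rw [add_assoc, add_assoc, add_assoc]
    exact le_self_add
  · gcongr
    refine hle _ ?_
    rw [add_comm A₁, add_assoc, add_assoc, add_assoc]
    exact le_self_add
  · gcongr
    refine hle _ ?_
    rw [add_comm _ A₃, add_assoc, add_assoc]
    exact le_self_add
  · gcongr
    refine hle _ ?_
    rw [add_comm _ A₄, add_assoc]
    exact le_self_add

/-- A series of distributions with absolutely summable `L_2` norms converges in `𝓢'`, with the
expected bound for the sum. -/
theorem exists_hasSum_of_distLpNorm_two_le {F : ℤ → 𝓢'(R3, C3)} {B : ℤ → ℝ}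
    (hB : Summable B) (hF : ∀ j, distLpNorm 2 (F j) < ENNReal.ofReal (B j)) :
    ∃ f : 𝓢'(R3, C3), HasSum F f ∧ distLpNorm 2 f ≤ ENNReal.ofReal (∑' j, B j) := by
  choose u hu hlt using fun j => exists_toTemperedDistribution_eq_of_distLpNorm_lt (hF j)
  have hnorm : ∀ j, ‖u j‖ ≤ B j := fun j => by
    have h := hlt j
    rw [← ofReal_norm] at h
    exact ((ENNReal.ofReal_lt_ofReal_iff').1 h).1.le
  have hs : Summable u := hB.of_norm_bounded hnorm
  refine ⟨((∑' j, u j : Lp C3 2 (volume : Measure R3)) : 𝓢'(R3, C3)), ?_, ?_⟩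
  · have h1 := hs.hasSum.mapL (Lp.toTemperedDistributionCLM C3 (volume : Measure R3) 2)
    have e : F = fun j => Lp.toTemperedDistributionCLM C3 (volume : Measure R3) 2 (u j) :=
      funext hu
    rw [e]
    exact h1
  · refine (distLpNorm_toTemperedDistribution_le _).trans ?_
    rw [← ofReal_norm]
    exact ENNReal.ofReal_le_ofReal (tsum_of_norm_bounded hB.hasSum hnorm)

/-- Below the splitting frequency the weight dominates the exponent given by Bernstein's
inequality for an untruncated block. -/
theorem regularWeight_of_lt {p : ℝ} (hp : 3 < p) {J j : ℤ} (hj : j < J) :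
    3 * (j : ℝ) / (2 * p) + j * (1 - 3 / p) ≤ regularWeight p J j := by
  have hjR : (j : ℝ) - J ≤ 0 := by
    have : (j : ℝ) ≤ J := by exact_mod_cast hj.le
    linarith
  have h3 := regularityGain_pos hp
  rw [regularWeight, critIndex_two_mul, abs_of_nonpos hjR]
  have e : 3 * (j : ℝ) / (2 * p) = j * (3 / p / 2) := by
    field_simp
  rw [e]
  nlinarith

/-- The decomposition of a divergence-free distribution at the splitting frequency `2 ^ J`, with
estimates for the individual dyadic blocks. -/
theorem exists_decomposition {χ φ : R3 → ℝ} (h : IsLittlewoodPaleyPair χ φ) {p : ℝ} (hp : 3 < p) :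
    ∃ A : ℝ, 0 < A ∧ ∀ (g : 𝓢'(R3, C3)) (M : ℝ), 0 ≤ M → IsDivFree g →
      (∀ j, distLpNorm (ENNReal.ofReal p) (dyadicCutoff φ j g) ≤
        ENNReal.ofReal (M * (2 : ℝ) ^ (j * (1 - 3 / p)))) →
      ∀ J : ℤ, ∃ gBar gTilde : 𝓢'(R3, C3), g = gBar + gTilde ∧
        IsDivFree gBar ∧ IsDivFree gTilde ∧ (IsReal g → IsReal gBar ∧ IsReal gTilde) ∧
        (∀ k, k ≤ J - 2 → dyadicCutoff χ k gTilde = 0) ∧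
        (∀ k, distLpNorm (ENNReal.ofReal p) (dyadicCutoff φ k gBar) ≤
          ENNReal.ofReal (A * (M + 1) * (2 : ℝ) ^ (k * (1 - 3 / p)))) ∧
        (∀ k, distLpNorm (ENNReal.ofReal p) (dyadicCutoff φ k gTilde) ≤
          ENNReal.ofReal (A * (M + 1) * (2 : ℝ) ^ (k * (1 - 3 / p)))) ∧
        (∀ k, distLpNorm (ENNReal.ofReal (2 * p)) (dyadicCutoff φ k gBar) ≤
          ENNReal.ofReal (A * (M + 1) * (2 : ℝ) ^ regularWeight p J k)) ∧
        distLpNorm 2 gTilde ≤ ENNReal.ofReal (A * (M + 1) * (2 : ℝ) ^ (-(J / 2 : ℝ))) := by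
  have hφ := h.isAnnularSymbol_φ
  have ha := h.isAnnularSymbol_evenPart
  have hθ := h.isAnnularSymbol_fattened
  set a := evenPart φ with ha_def
  set θ := fattened a with hθ_def
  obtain ⟨K, hK, hKφ, hKa, hKθ, hKB⟩ := exists_uniform_multiplier_bound h (by linarith : 1 < p)
  set G : ℝ := ∑' j : ℤ, (2 : ℝ) ^ (-(1 / 8 * |(j : ℝ)|)) with hG
  have hGnn : 0 ≤ G := tsum_nonneg fun j => by positivity
  have hp1 : 1 < p := by linarith
  have : Fact (1 ≤ ENNReal.ofReal p) := ⟨by rw [ENNReal.one_le_ofReal]; linarith⟩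
  have : Fact (1 ≤ ENNReal.ofReal (2 * p)) := ⟨by rw [ENNReal.one_le_ofReal]; linarith⟩
  refine ⟨(40 * K ^ 2 + 2 * K * G) * (40 * K), by positivity, fun g M hM hg hgM J => ?_⟩
  set M' : ℝ := 40 * K * (M + 1) with hM'
  have hM'pos : 0 < M' := by positivity
  have hA1 : 40 * K ^ 2 * M' ≤ (40 * K ^ 2 + 2 * K * G) * (40 * K) * (M + 1) := by
    have : 0 ≤ 2 * K * G * M' := by positivity
    rw [hM'] at *
    linarith
  have hA2 : 2 * K * G * M' ≤ (40 * K ^ 2 + 2 * K * G) * (40 * K) * (M + 1) := by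
    have : 0 ≤ 40 * K ^ 2 * M' := by positivity
    rw [hM'] at *
    linarith
  have hwin : ∀ k : ℤ, Finset.Icc (k - 1) (k + 1) ⊆ Finset.Icc (k - 2) (k + 2) := fun k =>
    Finset.Icc_subset_Icc (by omega) (by omega)
  -- the blocks with respect to the even partition of unity inherit the bound on `g`
  have hblock : ∀ j, distLpNorm (ENNReal.ofReal p) (dyadicCutoff a j g) <
      ENNReal.ofReal (M' * (2 : ℝ) ^ (j * (1 - 3 / p))) := by
    intro j
    rw [dyadicCutoff_eq_sum ha hφ h.sum_int (hwin j) g]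
    refine lt_of_le_of_lt ((distLpNorm_sum_le _ _).trans (sum_window_le (c := K * M)
      (w := fun j : ℤ => (j : ℝ) * (1 - 3 / p)) (by positivity) (fun i _ => ?_)
      fun i hi => critWeight_le hp hi)) ?_
    · refine (hKa p hp1 j _).trans ?_
      rw [mul_assoc, ENNReal.ofReal_mul hK.le]
      gcongr
      exact hgM i
    · rw [ENNReal.ofReal_lt_ofReal_iff (by positivity), hM']
      have : 0 < (2 : ℝ) ^ ((j : ℝ) * (1 - 3 / p)) := by positivity
      nlinarith [mul_pos hK this]
  choose b s hbs hbreal hb0 hbp hsp hb2 hs2 using fun j =>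
    exists_block_splitting hp hM'pos J j (hblock j)
  have hsum : ∀ j, lerayBlock θ j (dyadicCutoff a j g) = dyadicCutoff a j g := fun j =>
    hg.lerayBlock_dyadicCutoff hθ (by norm_num) ha (by norm_num) h.evenPart_mul_fattened j
  -- the irregular part is the sum of the projected tall parts, absolutely convergent in `L_2`
  obtain ⟨gT, hgT, hgT2⟩ := exists_hasSum_of_distLpNorm_two_le
    (F := fun j => lerayBlock θ j (b j))
    (B := fun j : ℤ => 2 * K * M' * (2 : ℝ) ^ (-(J / 2 : ℝ)) *
      (2 : ℝ) ^ (-(1 / 8 * |(j : ℝ) - J|)))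
    ((summable_two_rpow_neg_abs_sub (by norm_num) J).mul_left _) (fun j => by
      have h1 := hKθ 2 one_lt_two j (b j)
      rw [ENNReal.ofReal_ofNat] at h1
      refine lt_of_le_of_lt (h1.trans (mul_le_mul_right (hb2 j) _)) ?_
      rw [← ENNReal.ofReal_mul hK.le, ENNReal.ofReal_lt_ofReal_iff (by positivity),
        sub_eq_add_neg, Real.rpow_add zero_lt_two]
      have : 0 < K * (M' * ((2 : ℝ) ^ (-(J / 2 : ℝ)) * (2 : ℝ) ^ (-(1 / 8 * |(j : ℝ) - J|)))) := by
        positivity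
      linarith)
  rw [tsum_mul_left, tsum_two_rpow_neg_abs_sub, ← hG] at hgT2
  have hdivT : IsDivFree gT :=
    IsDivFree.of_hasSum hgT fun j => isDivFree_lerayBlock hθ (by norm_num) j (b j)
  have hrealT : IsReal g → IsReal gT := fun hgr => IsReal.of_hasSum hgT fun j =>
    (hbreal j (hgr.dyadicCutoff ha (evenPart_neg φ) j)).lerayBlock hθ (by norm_num)
      (fattened_evenPart_neg φ) j
  -- frequency localization: only five projected blocks interact with a given dyadic block
  have hloc : ∀ k j, j ∉ Finset.Icc (k - 2) (k + 2) → ∀ f : 𝓢'(R3, C3),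
      dyadicCutoff φ k (lerayBlock θ j f) = 0 := by
    intro k j hj f
    refine dyadicCutoff_lerayBlock_eq_zero hφ hθ (by norm_num) (fun ξ h1 h2 => hj ?_) f
    have h3 := hφ.index_lt hθ (by norm_num) (c := 3) (by norm_num) h1 h2
    have h4 := hθ.index_lt hφ (by norm_num) (c := 3) (by norm_num) h2 h1
    exact Finset.mem_Icc.2 ⟨by omega, by omega⟩
  have hTk : ∀ k, dyadicCutoff φ k gT =
      ∑ j ∈ Finset.Icc (k - 2) (k + 2), dyadicCutoff φ k (lerayBlock θ j (b j)) := by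
    intro k
    have h1 : HasSum (fun j => dyadicCutoff φ k (lerayBlock θ j (b j))) (dyadicCutoff φ k gT) :=
      hgT.mapL (TemperedDistribution.fourierMultiplierCLM C3 _)
    exact h1.unique (hasSum_sum_of_ne_finset_zero fun j hj => hloc k j hj _)
  have hBk : ∀ k, dyadicCutoff φ k (g - gT) =
      ∑ j ∈ Finset.Icc (k - 2) (k + 2), dyadicCutoff φ k (lerayBlock θ j (s j)) := by
    intro k
    rw [dyadicCutoff_sub, hTk, dyadicCutoff_eq_sum hφ ha h.hasSum_evenPart (hwin k) g,
      ← Finset.sum_sub_distrib]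
    refine Finset.sum_congr rfl fun j _ => ?_
    rw [← hsum j, ← dyadicCutoff_sub, ← map_sub, hbs j, add_sub_cancel_left]
  have hp_bound : ∀ (F : ℤ → 𝓢'(R3, C3)), (∀ j, distLpNorm (ENNReal.ofReal p) (F j) ≤
      ENNReal.ofReal (M' * (2 : ℝ) ^ (j * (1 - 3 / p)))) → ∀ k,
      distLpNorm (ENNReal.ofReal p)
        (∑ j ∈ Finset.Icc (k - 2) (k + 2), dyadicCutoff φ k (lerayBlock θ j (F j))) ≤
      ENNReal.ofReal ((40 * K ^ 2 + 2 * K * G) * (40 * K) * (M + 1) *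
        (2 : ℝ) ^ (k * (1 - 3 / p))) := by
    intro F hF k
    refine ((distLpNorm_sum_le _ _).trans (sum_window_le (c := K ^ 2 * M')
      (w := fun j : ℤ => (j : ℝ) * (1 - 3 / p)) (by positivity) (fun i _ => ?_)
      fun i hi => critWeight_le hp hi)).trans ?_
    · refine (hKφ p hp1 k _).trans ?_
      rw [sq, mul_assoc, mul_assoc, ENNReal.ofReal_mul hK.le, ENNReal.ofReal_mul hK.le]
      gcongr
      exact (hKθ p hp1 i _).trans (mul_le_mul_right (hF i) _)
    · rw [← mul_assoc]
      gcongr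
  -- the `L_{2p}` bound of the projected short parts: Bernstein's inequality below the
  -- splitting frequency, truncation above it
  have hs2' : ∀ j, distLpNorm (ENNReal.ofReal (2 * p)) (lerayBlock θ j (s j)) ≤
      ENNReal.ofReal (K * (M' * (2 : ℝ) ^ regularWeight p J j)) := by
    intro j
    rw [ENNReal.ofReal_mul hK.le]
    rcases lt_or_ge j J with hj | hj
    · refine (hKB j (s j)).trans ?_
      rw [mul_assoc]
      gcongr
      refine (mul_le_mul_right (hsp j) _).trans ?_
      rw [← ENNReal.ofReal_mul (by positivity)]
      refine ENNReal.ofReal_le_ofReal ?_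
      rw [mul_left_comm, ← Real.rpow_add zero_lt_two]
      gcongr
      · exact one_le_two
      · exact regularWeight_of_lt hp hj
    · exact (hKθ (2 * p) (by linarith) j (s j)).trans (mul_le_mul_right (hs2 j hj) _)
  refine ⟨g - gT, gT, (sub_add_cancel g gT).symm, hg.sub hdivT, hdivT,
    fun hgr => ⟨hgr.sub (hrealT hgr), hrealT hgr⟩, fun k hk => ?_, fun k => ?_, fun k => ?_,
    fun k => ?_, hgT2.trans (ENNReal.ofReal_le_ofReal ?_)⟩
  · have h1 : HasSum (fun j => dyadicCutoff χ k (lerayBlock θ j (b j))) (dyadicCutoff χ k gT) :=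
      hgT.mapL (TemperedDistribution.fourierMultiplierCLM C3 _)
    refine h1.unique ?_
    convert! hasSum_zero with j
    rcases lt_or_ge j J with hj | hj
    · rw [hb0 j hj, map_zero]
      exact map_zero (TemperedDistribution.fourierMultiplierCLM C3 _)
    · refine dyadicCutoff_lerayBlock_eq_zero h.isAnnularSymbol_χ hθ (by norm_num)
        (fun ξ h1 h2 => ?_) _
      have := h.isAnnularSymbol_χ.index_lt hθ (by norm_num) (c := 2) (by norm_num) h1 h2
      omega
  · rw [hBk k]; exact hp_bound s hsp k
  · rw [hTk k]; exact hp_bound b hbp k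
  · rw [hBk k]
    refine ((distLpNorm_sum_le _ _).trans (sum_window_le (c := K ^ 2 * M')
      (w := regularWeight p J) (by positivity) (fun i _ => ?_)
      fun i hi => regularWeight_le hp J hi)).trans ?_
    · refine (hKφ (2 * p) (by linarith) k _).trans ?_
      rw [sq, mul_assoc, mul_assoc, ENNReal.ofReal_mul hK.le]
      gcongr
      exact hs2' i
    · rw [← mul_assoc]
      gcongr
  · calc _ = 2 * K * G * M' * (2 : ℝ) ^ (-(J / 2 : ℝ)) := by ring
      _ ≤ _ := by gcongr

/-! ### Besov norms -/

theorem distLpNorm_le_of_besovNorm_top {φ : R3 → ℝ} {p : ℝ} {f : 𝓢'(R3, C3)} {M : ℝ≥0}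
    (hf : besovNorm φ (critIndex p) (ENNReal.ofReal p) ⊤ f ≤ M) (j : ℤ) :
    distLpNorm (ENNReal.ofReal p) (dyadicCutoff φ j f) ≤
      ENNReal.ofReal (M * (2 : ℝ) ^ (j * (1 - 3 / p))) := by
  rw [besovNorm, if_pos rfl] at hf
  have h1 := (le_iSup (fun j : ℤ => ENNReal.ofReal ((2 : ℝ) ^ ((j : ℝ) * critIndex p)) *
    distLpNorm (ENNReal.ofReal p) (dyadicCutoff φ j f)) j).trans hf
  have h2 : ENNReal.ofReal ((2 : ℝ) ^ (j * (1 - 3 / p))) *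
      ENNReal.ofReal ((2 : ℝ) ^ ((j : ℝ) * critIndex p)) = 1 := by
    rw [← ENNReal.ofReal_mul (by positivity), ← Real.rpow_add zero_lt_two, critIndex]
    simp [show (j : ℝ) * (1 - 3 / p) + j * (-1 + 3 / p) = 0 by ring]
  calc _ = ENNReal.ofReal ((2 : ℝ) ^ (j * (1 - 3 / p))) *
        (ENNReal.ofReal ((2 : ℝ) ^ ((j : ℝ) * critIndex p)) *
          distLpNorm (ENNReal.ofReal p) (dyadicCutoff φ j f)) := by rw [← mul_assoc, h2, one_mul]
    _ ≤ ENNReal.ofReal ((2 : ℝ) ^ (j * (1 - 3 / p))) * M := by gcongr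
    _ = _ := by
      rw [mul_comm, ENNReal.ofReal_mul M.coe_nonneg, ENNReal.ofReal_coe_nnreal]

theorem besovNorm_top_le {φ : R3 → ℝ} {p B : ℝ} {f : 𝓢'(R3, C3)}
    (hf : ∀ k : ℤ, distLpNorm (ENNReal.ofReal p) (dyadicCutoff φ k f) ≤
      ENNReal.ofReal (B * (2 : ℝ) ^ (k * (1 - 3 / p)))) :
    besovNorm φ (critIndex p) (ENNReal.ofReal p) ⊤ f ≤ ENNReal.ofReal B := by
  rw [besovNorm, if_pos rfl]
  refine iSup_le fun k => (mul_le_mul_right (hf k) _).trans_eq ?_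
  rw [← ENNReal.ofReal_mul (by positivity), mul_left_comm, ← Real.rpow_add zero_lt_two, critIndex]
  simp [show (k : ℝ) * (-1 + 3 / p) + k * (1 - 3 / p) = 0 by ring]

/-- The geometric series of the weights of the regular part. -/
def weightSum (p : ℝ) : ℝ := ∑' j : ℤ, (2 : ℝ) ^ (-(regularityGain p * p * |(j : ℝ)|))

theorem besovNorm_two_mul_le {φ : R3 → ℝ} {p B : ℝ} (hp : 3 < p) (hB : 0 ≤ B) {J : ℤ}
    {f : 𝓢'(R3, C3)}
    (hf : ∀ k, distLpNorm (ENNReal.ofReal (2 * p)) (dyadicCutoff φ k f) ≤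
      ENNReal.ofReal (B * (2 : ℝ) ^ regularWeight p J k)) :
    besovNorm φ (critIndex (2 * p) + regularityGain p) (ENNReal.ofReal (2 * p))
        (ENNReal.ofReal (2 * p)) f ≤
      ENNReal.ofReal (B * (2 : ℝ) ^ (J * regularityGain p) * weightSum p ^ (1 / (2 * p))) := by
  have h2p : 0 < 2 * p := by linarith
  have hc : 0 < regularityGain p * p := mul_pos (regularityGain_pos hp) (by linarith)
  have hW : 0 ≤ weightSum p := tsum_nonneg fun j => by positivity
  rw [besovNorm, if_neg ENNReal.ofReal_ne_top, ENNReal.toReal_ofReal h2p.le]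
  set D : ℝ := B * (2 : ℝ) ^ (J * regularityGain p) with hD
  have hD0 : 0 ≤ D := by positivity
  have hterm : ∀ k : ℤ, ENNReal.ofReal
        ((2 : ℝ) ^ ((k : ℝ) * (critIndex (2 * p) + regularityGain p) * (2 * p))) *
        distLpNorm (ENNReal.ofReal (2 * p)) (dyadicCutoff φ k f) ^ (2 * p) ≤
      ENNReal.ofReal (D ^ (2 * p) * (2 : ℝ) ^ (-(regularityGain p * p * |(k : ℝ) - J|))) := by
    intro k
    refine (mul_le_mul_right (ENNReal.rpow_le_rpow (hf k) h2p.le) _).trans_eq ?_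
    rw [ENNReal.ofReal_rpow_of_nonneg (by positivity) h2p.le,
      ← ENNReal.ofReal_mul (by positivity), hD, Real.mul_rpow hB (by positivity),
      Real.mul_rpow hB (by positivity), ← Real.rpow_mul zero_le_two, ← Real.rpow_mul zero_le_two,
      mul_left_comm, ← Real.rpow_add zero_lt_two, mul_assoc (B ^ (2 * p)),
      ← Real.rpow_add zero_lt_two]
    congr 3
    rw [regularWeight]
    ring
  calc _ ≤ (ENNReal.ofReal (D ^ (2 * p) * weightSum p)) ^ (1 / (2 * p)) := by
        refine ENNReal.rpow_le_rpow ((ENNReal.tsum_le_tsum hterm).trans_eq ?_) (by positivity)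
        rw [← ENNReal.ofReal_tsum_of_nonneg (fun j => by positivity)
          ((summable_two_rpow_neg_abs_sub hc J).mul_left _), tsum_mul_left,
          tsum_two_rpow_neg_abs_sub, weightSum]
    _ = _ := by
        rw [ENNReal.ofReal_rpow_of_nonneg (by positivity) (by positivity),
          Real.mul_rpow (by positivity) hW, ← Real.rpow_mul hD0, mul_one_div_cancel h2p.ne',
          Real.rpow_one]

end HomBesov

end

open HomBesov
theorem mainTheorem1 (p : ℝ) (hp : 3 < p) :
    ∃ p₂ δ₂ γ₁ γ₂ : ℝ, p < p₂ ∧ 0 < δ₂ ∧ δ₂ < -critIndex p₂ ∧ 0 < γ₁ ∧ 0 < γ₂ ∧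
      ∀ χ φ : R3 → ℝ, IsLittlewoodPaleyPair χ φ →
        ∃ C : ℝ≥0 → ℝ≥0, ∀ g : 𝓢'(R3, C3),
          MemBesov χ φ (critIndex p) (ENNReal.ofReal p) ⊤ g →
          IsDivFree g →
          ∀ N : ℝ, 0 < N → ∃ gBar gTilde : 𝓢'(R3, C3),
            IsDivFree gBar ∧ IsDivFree gTilde ∧
            (IsReal g → IsReal gBar ∧ IsReal gTilde) ∧
            MemBesov χ φ (critIndex p₂ + δ₂)
              (ENNReal.ofReal p₂) (ENNReal.ofReal p₂) gBar ∧
            MemBesov χ φ (critIndex p) (ENNReal.ofReal p) ⊤ gBar ∧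
            distLpNorm 2 gTilde < ⊤ ∧
            MemBesov χ φ (critIndex p) (ENNReal.ofReal p) ⊤ gTilde ∧
            g = gBar + gTilde ∧
            besovNorm φ (critIndex p₂ + δ₂)
                (ENNReal.ofReal p₂) (ENNReal.ofReal p₂) gBar ≤
              ENNReal.ofReal (N ^ γ₁) *
                C (besovNorm φ (critIndex p)
                  (ENNReal.ofReal p) ⊤ g).toNNReal ∧
            distLpNorm 2 gTilde ≤
              ENNReal.ofReal (N ^ (-γ₂)) *
                C (besovNorm φ (critIndex p)
                  (ENNReal.ofReal p) ⊤ g).toNNReal ∧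
            besovNorm φ (critIndex p) (ENNReal.ofReal p) ⊤ gBar ≤
              C (besovNorm φ (critIndex p)
                (ENNReal.ofReal p) ⊤ g).toNNReal ∧
            besovNorm φ (critIndex p) (ENNReal.ofReal p) ⊤ gTilde ≤
              C (besovNorm φ (critIndex p)
                (ENNReal.ofReal p) ⊤ g).toNNReal := by
  have hδ := regularityGain_pos hp
  have hδ' := regularityGain_lt hp
  have ht := three_div_lt_one hp
  refine ⟨2 * p, regularityGain p, regularityGain p, 1 / 2, by linarith, hδ, ?_, hδ, by norm_num,
    fun χ φ h => ?_⟩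
  · rw [critIndex_two_mul]; linarith
  obtain ⟨A, hA, hdec⟩ := exists_decomposition h hp
  have hW : 0 ≤ weightSum p := tsum_nonneg fun j => by positivity
  set W : ℝ := weightSum p ^ (1 / (2 * p)) with hWdef
  have hW0 : 0 ≤ W := by positivity
  refine ⟨fun M => (A * (M + 1) * (W + 2)).toNNReal, fun g hg hdiv N hN => ?_⟩
  set M : ℝ≥0 := (besovNorm φ (critIndex p) (ENNReal.ofReal p) ⊤ g).toNNReal with hM
  have hMeq : besovNorm φ (critIndex p) (ENNReal.ofReal p) ⊤ g = M :=
    (ENNReal.coe_toNNReal hg.2.ne).symm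
  -- the splitting frequency `2 ^ J` is comparable to `N`
  set J : ℤ := Int.log 2 N with hJ
  have hJ1 : (2 : ℝ) ^ J ≤ N := by exact_mod_cast Int.zpow_log_le_self (b := 2) one_lt_two hN
  have hJ2 : N < (2 : ℝ) ^ (J + 1) := by exact_mod_cast Int.lt_zpow_succ_log_self one_lt_two N
  obtain ⟨gB, gT, hsum, hdB, hdT, hre, hlow, hBp, hTp, hB2, hT2⟩ :=
    hdec g M M.coe_nonneg hdiv (distLpNorm_le_of_besovNorm_top hMeq.le) J
  set c : ℝ := A * (M + 1) with hc
  have hc0 : 0 ≤ c := by positivity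
  have hC : ((c * (W + 2)).toNNReal : ℝ≥0∞) = ENNReal.ofReal (c * (W + 2)) := rfl
  have hcC : ENNReal.ofReal c ≤ ((c * (W + 2)).toNNReal : ℝ≥0∞) :=
    ENNReal.ofReal_le_ofReal (by nlinarith)
  have hBtop := (besovNorm_top_le hBp).trans hcC
  have hTtop := (besovNorm_top_le hTp).trans hcC
  have hBreg : besovNorm φ (critIndex (2 * p) + regularityGain p) (ENNReal.ofReal (2 * p))
      (ENNReal.ofReal (2 * p)) gB ≤
        ENNReal.ofReal (N ^ regularityGain p) * ((c * (W + 2)).toNNReal : ℝ≥0∞) := by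
    refine (besovNorm_two_mul_le hp hc0 hB2).trans ?_
    rw [hC, ← ENNReal.ofReal_mul (by positivity)]
    refine ENNReal.ofReal_le_ofReal ?_
    have h1 : (2 : ℝ) ^ ((J : ℝ) * regularityGain p) ≤ N ^ regularityGain p := by
      rw [Real.rpow_mul zero_le_two, Real.rpow_intCast]
      exact Real.rpow_le_rpow (by positivity) hJ1 hδ.le
    calc c * (2 : ℝ) ^ ((J : ℝ) * regularityGain p) * W
        ≤ c * N ^ regularityGain p * (W + 2) := by gcongr; linarith
      _ = _ := by ring
  have hTL2 : distLpNorm 2 gT ≤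
      ENNReal.ofReal (N ^ (-(1 / 2 : ℝ))) * ((c * (W + 2)).toNNReal : ℝ≥0∞) := by
    refine hT2.trans ?_
    rw [hC, ← ENNReal.ofReal_mul (by positivity)]
    refine ENNReal.ofReal_le_ofReal ?_
    have h1 : (2 : ℝ) ^ (-(J / 2 : ℝ)) ≤ 2 * N ^ (-(1 / 2 : ℝ)) := by
      have h2 : ((2 : ℝ) ^ (J + 1)) ^ (-(1 / 2 : ℝ)) ≤ N ^ (-(1 / 2 : ℝ)) :=
        Real.rpow_le_rpow_of_nonpos hN hJ2.le (by norm_num)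
      have h3 : (2 : ℝ) ^ (-(J / 2 : ℝ)) =
          (2 : ℝ) ^ (1 / 2 : ℝ) * ((2 : ℝ) ^ (J + 1)) ^ (-(1 / 2 : ℝ)) := by
        rw [← Real.rpow_intCast, ← Real.rpow_mul zero_le_two, ← Real.rpow_add zero_lt_two]
        congr 1; push_cast; ring
      have h4 : (2 : ℝ) ^ (1 / 2 : ℝ) ≤ 2 := by
        conv_rhs => rw [← Real.rpow_one 2]
        exact Real.rpow_le_rpow_of_exponent_le one_le_two (by norm_num)
      rw [h3]
      gcongr
    calc c * (2 : ℝ) ^ (-(J / 2 : ℝ)) ≤ c * (2 * N ^ (-(1 / 2 : ℝ))) := by gcongr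
      _ = N ^ (-(1 / 2 : ℝ)) * (c * 2) := by ring
      _ ≤ _ := by gcongr; linarith
  -- `gT` has no low frequencies, so the low frequencies of `gB` are those of `g`
  have hTlow : Tendsto (fun j : ℤ => distLpNorm ⊤ (dyadicCutoff χ j gT)) atBot (𝓝 0) := by
    refine tendsto_const_nhds.congr' ?_
    filter_upwards [eventually_le_atBot (J - 2)] with k hk
    rw [hlow k hk, distLpNorm_zero]
  have hBlow : Tendsto (fun j : ℤ => distLpNorm ⊤ (dyadicCutoff χ j gB)) atBot (𝓝 0) := by
    refine hg.1.congr' ?_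
    filter_upwards [eventually_le_atBot (J - 2)] with k hk
    rw [eq_sub_of_add_eq hsum.symm, dyadicCutoff_sub, hlow k hk, sub_zero]
  have hfin : ∀ r : ℝ, ENNReal.ofReal r * ((c * (W + 2)).toNNReal : ℝ≥0∞) < ⊤ := fun r =>
    ENNReal.mul_lt_top ENNReal.ofReal_lt_top ENNReal.coe_lt_top
  exact ⟨gB, gT, hdB, hdT, hre, ⟨hBlow, hBreg.trans_lt (hfin _)⟩,
    ⟨hBlow, hBtop.trans_lt ENNReal.coe_lt_top⟩, hTL2.trans_lt (hfin _),
    ⟨hTlow, hTtop.trans_lt ENNReal.coe_lt_top⟩, hsum, hBreg, hTL2, hBtop, hTtop⟩
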